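/- Let $T>0$, let $M,C,K$ be real $N\times N$ matrices with $M$ symmetric positive definite, $B$ a real $N\times p$ matrix, $F\in L^2(]0,T[;\mathbb R^N)$, $X_0,X_1\in\mathbb R^N$, and let $\varepsilon>0$, $\alpha\ge 0$, $\beta>0$, $\gamma>0$. Write $|\cdot|$ and $(\cdot,\cdot)$ for the Euclidean norm and scalar product and $H=[H^1_0(]0,T[)]^p$ with the $H^1$ norm. For $v\in H$ let $X=X_v\in H^2$ be the state, i.e. the solution of $M\ddot X+C\dot X+KX=F+Bv$, $X(0)=X_0$, $\dot X(0)=X_1$, and let $$J(v)=\tfrac12\Big(|X_v(T)|^2+|\dot X_v(T)|^2+\varepsilon\int_0^T\big[\alpha|v|^2+\beta|v'|^2+2\gamma|v'|\big]\,dt\Big).$$ There is a unique minimizer $u^\varepsilon$ of $J$ over $H$. Put $X^\varepsilon=X_{u^\varepsilon}$. There is an adjoint state $P^\varepsilon$, i.e. a solution on $[0,T]$ of $$M\ddot P-{}^tC\dot P+{}^tKP=0,\qquad MP(T)=\dot X^\varepsilon(T),\qquad M\dot P(T)=-X^\varepsilon(T)+{}^tCP(T).$$ Fix it. For every $\eta>0$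 the functional $$v\mapsto \frac{\varepsilon}{2}\int_0^T\Big[\alpha|v|^2+\beta|v'|^2+2\gamma\big(\sqrt{\eta+|v'|^2}-\sqrt\eta\big)\Big]dt+\int_0^T({}^tBP^\varepsilon,v)\,dt$$ has a unique minimizer $u^{\varepsilon,\eta}$ in $H$. Put $\lambda^{\varepsilon,\eta}=(u^{\varepsilon,\eta})'/\sqrt{\eta+|(u^{\varepsilon,\eta})'|^2}$ and $B_1=\{\mu\in\mathbb R^p:|\mu|\le 1\}$. Then there is $\lambda^\varepsilon\in L^\infty(]0,T[;\mathbb R^p)$ such that: 1. as $\eta\to0^+$, $u^{\varepsilon,\eta}\to u^\varepsilon$ strongly in $H$, and $\lambda^{\varepsilon,\eta}\to\lambda^\varepsilon$ weakly-$*$ in $L^\infty(]0,T[;\mathbb R^p)$; 2. $(u,\lambda)=(u^\varepsilon,\lambda^\varepsilon)$ solves the mixed formulation: for all $v\in H$, $$\varepsilon\int_0^T\big[\alpha(u,v)+\beta(u',v')+\gamma(\lambda,v')\big]dt+\int_0^T({}^tBP^\varepsilon,v)\,dt=0,$$ and for almost every $t\in\,]0,T[$, $\lambda(t)\in B_1$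 and $(\mu-\lambda(t),u'(t))\le0$ for all $\mu\in B_1$; 3. $(\lambda^\varepsilon,(u^\varepsilon)')=|(u^\varepsilon)'|$ almost everywhere on $]0,T[$; 4. every solution $(u,\lambda)\in H\times L^\infty(]0,T[;\mathbb R^p)$ of the mixed formulation satisfies $u=u^\varepsilon$, and moreover $\lambda=\lambda^\varepsilon$ almost everywhere unless $u^\varepsilon=0$. -/

import Mathlib

open MeasureTheory Filter Topology Set

noncomputable section

namespace OptCtrl

/-- `ℝ^m` with its Euclidean norm and scalar product. -/
abbrev Vec (m : ℕ) : Type := EuclideanSpace ℝ (Fin m)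

/-- A real matrix acting on Euclidean vectors. -/
abbrev act {m n : ℕ} (A : Matrix (Fin m) (Fin n) ℝ) (x : Vec n) : Vec m :=
  WithLp.toLp 2 (A.mulVec x.ofLp)

/-- Lebesgue measure on the open interval `]0,T[`. -/
abbrev leb (T : ℝ) : Measure ℝ := volume.restrict (Ioo 0 T)

/-- `L²(]0,T[; ℝ^m)`. -/
abbrev L2 (m : ℕ) (T : ℝ) : Type := Lp (Vec m) 2 (leb T)

/-- `C_c^∞(]0,T[; ℝ^m)`. -/
structure IsTest (m : ℕ) (T : ℝ) (φ : ℝ → Vec m) : Prop where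
  smooth : ContDiff ℝ ((⊤ : ℕ∞) : WithTop ℕ∞) φ
  compact : HasCompactSupport φ
  support : tsupport φ ⊆ Ioo 0 T

theorem IsTest.add {m : ℕ} {T : ℝ} {φ ψ : ℝ → Vec m} (h : IsTest m T φ) (k : IsTest m T ψ) :
    IsTest m T (φ + ψ) :=
  ⟨h.smooth.add k.smooth, h.compact.add k.compact,
    (tsupport_add φ ψ).trans (union_subset h.support k.support)⟩

theorem IsTest.smul {m : ℕ} {T : ℝ} {φ : ℝ → Vec m} (c : ℝ) (h : IsTest m T φ) :
    IsTest m T (c • φ) :=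
  ⟨contDiff_const.smul h.smooth, h.compact.smul_left,
    (tsupport_smul_subset_right (fun _ => c) φ).trans h.support⟩

/-- The pairs `(φ, φ')`, `φ ∈ C_c^∞(]0,T[; ℝ^m)`, as a subspace of `L² × L²`. The latter carries
the norm `(‖f‖² + ‖g‖²)^(1/2)`, which on these pairs is the norm of `H¹`. -/
def testPairs (m : ℕ) (T : ℝ) : Submodule ℝ (WithLp 2 (L2 m T × L2 m T)) where
  carrier := {w | ∃ φ : ℝ → Vec m, IsTest m T φ ∧
    (w.fst : ℝ → Vec m) =ᵐ[leb T] φ ∧ (w.snd : ℝ → Vec m) =ᵐ[leb T] deriv φ}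
  zero_mem' := by
    refine ⟨0, ⟨contDiff_const, HasCompactSupport.zero, by simp [tsupport]⟩, ?_, ?_⟩
    · exact Lp.coeFn_zero _ _ _
    · have : deriv (0 : ℝ → Vec m) = 0 := by ext1 t; simp
      rw [this]
      exact Lp.coeFn_zero _ _ _
  add_mem' := by
    rintro a b ⟨φ, hφ, h1, h2⟩ ⟨ψ, hψ, k1, k2⟩
    refine ⟨φ + ψ, hφ.add hψ, ?_, ?_⟩
    · exact (Lp.coeFn_add a.fst b.fst).trans (h1.add k1)
    · have : deriv (φ + ψ) = deriv φ + deriv ψ := by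
        ext1 t
        exact deriv_add (hφ.smooth.differentiable (by simp) t)
          (hψ.smooth.differentiable (by simp) t)
      rw [this]
      exact (Lp.coeFn_add a.snd b.snd).trans (h2.add k2)
  smul_mem' := by
    rintro c a ⟨φ, hφ, h1, h2⟩
    refine ⟨c • φ, hφ.smul c, ?_, ?_⟩
    · exact (Lp.coeFn_smul c a.fst).trans (h1.const_smul c)
    · have : deriv (c • φ) = c • deriv φ := by
        ext1 t
        exact deriv_const_smul c (hφ.smooth.differentiable (by simp) t)
      rw [this]
      exact (Lp.coeFn_smul c a.snd).trans (h2.const_smul c)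

/-- `H¹₀(]0,T[; ℝ^m)`: the closure of `C_c^∞` in the `H¹` norm. An element is stored as the pair
`(v, v')` of an `L²` function and its weak derivative, with the norm of `H¹`. -/
abbrev H10 (m : ℕ) (T : ℝ) : Type := ↥(testPairs m T).topologicalClosure

/-- The function `v` of `v ∈ H¹₀`. -/
def H10.fn {m : ℕ} {T : ℝ} (v : H10 m T) : L2 m T := (v : WithLp 2 (L2 m T × L2 m T)).fst

/-- The derivative `v' = dv/dt` of `v ∈ H¹₀`. -/
def H10.der {m : ℕ} {T : ℝ} (v : H10 m T) : L2 m T := (v : WithLp 2 (L2 m T × L2 m T)).snd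

/-- The data of the control problem: horizon `T`, mass matrix `M`, damping `C`, stiffness `K`,
control matrix `B`, load `F`, initial position `X₀` and velocity `X₁`, and the coefficients
`ε, α, β, γ` of the criterion. -/
structure Data (N p : ℕ) where
  T : ℝ
  M : Matrix (Fin N) (Fin N) ℝ
  C : Matrix (Fin N) (Fin N) ℝ
  K : Matrix (Fin N) (Fin N) ℝ
  B : Matrix (Fin N) (Fin p) ℝ
  F : L2 N T
  X₀ : Vec N
  X₁ : Vec N
  ε : ℝ
  α : ℝ
  β : ℝ
  γ : ℝ

/-- The standing assumptions on the data. -/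
structure Data.Admissible {N p : ℕ} (D : Data N p) : Prop where
  T_pos : 0 < D.T
  M_posDef : D.M.PosDef
  ε_pos : 0 < D.ε
  α_nonneg : 0 ≤ D.α
  β_pos : 0 < D.β
  γ_pos : 0 < D.γ

namespace Data

variable {N p : ℕ} (D : Data N p)

/-- `X ∈ H²(]0,T[; ℝ^N)`, with velocity `V = X'`, is the solution of
`M X'' + C X' + K X = F + B u` almost everywhere on `]0,T[`, `X(0) = X₀`, `X'(0) = X₁`
(`X` and `V` are the continuous representatives on `[0,T]`, and `A = X''` is in `L²`). -/
def IsState (u : L2 p D.T) (X V : ℝ → Vec N) : Prop :=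
  ∃ A : L2 N D.T,
    (∀ t ∈ Icc 0 D.T, X t = D.X₀ + ∫ s in (0 : ℝ)..t, V s) ∧
    (∀ t ∈ Icc 0 D.T, V t = D.X₁ + ∫ s in (0 : ℝ)..t, A s) ∧
    ∀ᵐ t ∂leb D.T, act D.M (A t) + act D.C (V t) + act D.K (X t) = D.F t + act D.B (u t)

/-- The criterion `J(v)`, for a control `v` with state `X` and velocity `V`. -/
def cost (v : H10 p D.T) (X V : ℝ → Vec N) : ℝ :=
  (1 / 2) * (‖X D.T‖ ^ 2 + ‖V D.T‖ ^ 2 +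
    D.ε * ∫ t, (D.α * ‖v.fn t‖ ^ 2 + D.β * ‖v.der t‖ ^ 2 + 2 * D.γ * ‖v.der t‖) ∂leb D.T)

/-- `u` minimizes the criterion `J` over `H¹₀(]0,T[; ℝ^p)`. -/
def IsOptimalControl (u : H10 p D.T) : Prop :=
  ∃ X V, D.IsState u.fn X V ∧
    ∀ (v : H10 p D.T) (Y W : ℝ → Vec N), D.IsState v.fn Y W → D.cost u X V ≤ D.cost v Y W

/-- `P` is the adjoint state of the control `u`: with `X` the state of `u`,
`M P'' - Cᵗ P' + Kᵗ P = 0` on `[0,T]`, `M P(T) = X'(T)`, `M P'(T) = -X(T) + Cᵗ P(T)`. -/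
def IsAdjointState (u : H10 p D.T) (P : ℝ → Vec N) : Prop :=
  ∃ X V P' P'' : ℝ → Vec N, D.IsState u.fn X V ∧
    (∀ t ∈ Icc 0 D.T, HasDerivWithinAt P (P' t) (Icc 0 D.T) t) ∧
    (∀ t ∈ Icc 0 D.T, HasDerivWithinAt P' (P'' t) (Icc 0 D.T) t) ∧
    (∀ t ∈ Icc 0 D.T,
      act D.M (P'' t) - act D.C.transpose (P' t) + act D.K.transpose (P t) = 0) ∧
    act D.M (P D.T) = V D.T ∧
    act D.M (P' D.T) = -X D.T + act D.C.transpose (P D.T)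

/-- The regularized functional, in which `P` is given. -/
def regCost (P : ℝ → Vec N) (η : ℝ) (v : H10 p D.T) : ℝ :=
  D.ε / 2 * (∫ t, (D.α * ‖v.fn t‖ ^ 2 + D.β * ‖v.der t‖ ^ 2 +
      2 * D.γ * (√(η + ‖v.der t‖ ^ 2) - √η)) ∂leb D.T) +
    ∫ t, inner ℝ (act D.B.transpose (P t)) (v.fn t) ∂leb D.T

/-- `w` minimizes the regularized functional over `H¹₀(]0,T[; ℝ^p)`. -/
def IsRegMinimizer (P : ℝ → Vec N) (η : ℝ) (w : H10 p D.T) : Prop :=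
  ∀ v : H10 p D.T, D.regCost P η w ≤ D.regCost P η v

end Data

/-- The unit ball `B₁` of `ℝ^m`. -/
def B₁ (m : ℕ) : Set (Vec m) := {x | ‖x‖ ≤ 1}

/-- `L^∞(]0,T[; ℝ^m)`. -/
abbrev LInf (m : ℕ) (T : ℝ) : Type := Lp (Vec m) ⊤ (leb T)

/-- The multiplier `w' / √(η + |w'|²)` attached to `w ∈ H¹₀`. -/
def multiplier {m : ℕ} {T : ℝ} (η : ℝ) (w : H10 m T) : ℝ → Vec m :=
  fun t => (√(η + ‖w.der t‖ ^ 2))⁻¹ • w.der t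

/-- Convergence of `g i` to `lam` along the filter `l`, weakly-* in `L^∞(]0,T[; ℝ^m)`, the dual
of `L¹(]0,T[; ℝ^m)`. -/
def TendstoWeakStar {ι : Type} {m : ℕ} {T : ℝ} (g : ι → ℝ → Vec m) (l : Filter ι)
    (lam : LInf m T) : Prop :=
  (∀ᶠ i in l, MemLp (g i) ⊤ (leb T)) ∧
    ∀ f : Lp (Vec m) 1 (leb T),
      Tendsto (fun i => ∫ t, inner ℝ (g i t) (f t) ∂leb T) l
        (𝓝 (∫ t, inner ℝ (lam t) (f t) ∂leb T))

namespace Data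

variable {N p : ℕ} (D : Data N p)

/-- The pair `(u, lam)` solves the mixed formulation, in which `P` is given. -/
def IsMixedSolution (P : ℝ → Vec N) (u : H10 p D.T) (lam : LInf p D.T) : Prop :=
  (∀ v : H10 p D.T,
    D.ε * (∫ t, (D.α * inner ℝ (u.fn t) (v.fn t) + D.β * inner ℝ (u.der t) (v.der t) +
        D.γ * inner ℝ (lam t) (v.der t)) ∂leb D.T) +
      ∫ t, inner ℝ (act D.B.transpose (P t)) (v.fn t) ∂leb D.T = 0) ∧
  ∀ᵐ t ∂leb D.T, lam t ∈ B₁ p ∧ ∀ μ ∈ B₁ p, inner ℝ (μ - lam t) (u.der t) ≤ 0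

end Data

end OptCtrl

end

/-! All functionals here are strongly convex on `H¹₀`, through the term `β|v'|²` and the Poincaré
inequality, so existence and uniqueness of minimizers reduce to `existsUnique_minimizer`.

Convergence of the controls. Put `b = ᵗBP`. Integration by parts against `P` (`adjoint_pairing`)
shows that `b` represents the derivative at `u` of the final-state part of `J`. Hence `u` also
minimizes the criterion in which `(b, ·)` replaces that part, with quadratic growth
(`IsOptimalControl.quadratic_growth`). Regularizing `|v'|` changes this criterion by at most
`εγT√η`, so the regularized minimizers `w` satisfy `‖w - u‖² = O(√η)` (`tendsto_regMinimizer`).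

Convergence of the multipliers. It is even strong in `L²`. By the Euler equation the functional `v ↦
(λ, v')` depends continuously on `w`, so it converges in `H⁻¹`. It determines `λ` up to a constant
(du Bois-Reymond), and `|λ| ≤ 1`, whence compactness (`exists_tendsto_of_tendsto_der`). Each limit
point solves the mixed formulation (`isMixedL2_of_tendsto`), whose `u` is unique by monotonicity of
the subdifferential of the norm.

It remains to identify the limit points. If `u ≠ 0`, the multiplier is unique: two of them differ by
a constant and agree where `u' ≠ 0`. If `u = 0` there may be several. Now `√(η + |x|²)` is the
maximum over `|a| ≤ 1` of `(a, x) + √η √(1 - |a|²)`, attained at the multiplier. Hence the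
regularized multiplier gives `∫ √(1 - |λ|²)` a value that exceeds its value at any multiplier `l` of
`0` by at least `‖l - λ‖²/2` (`selector_add_le`). In the limit this leaves a single limit point. -/

noncomputable section

namespace OptCtrl

/-! ### Minimization of strongly convex functionals. -/

/-- A continuous functional that is bounded below and midpoint strongly convex has exactly one
minimizer. -/
theorem existsUnique_minimizer {E : Type*} [NormedAddCommGroup E] [NormedSpace ℝ E]
    [CompleteSpace E] {j : E → ℝ} (hj : Continuous j) {m κ : ℝ} (hm : ∀ v, m ≤ j v) (hκ : 0 < κ)
    (hc : ∀ u v, j ((1 / 2 : ℝ) • (u + v)) ≤ 1 / 2 * j u + 1 / 2 * j v - κ * ‖u - v‖ ^ 2) :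
    ∃! u, ∀ v, j u ≤ j v := by
  have hbdd : BddBelow (range j) := ⟨m, by rintro _ ⟨v, rfl⟩; exact hm v⟩
  set I := iInf j with hI
  have hIle : ∀ v, I ≤ j v := fun v => ciInf_le hbdd v
  have hex : ∀ n : ℕ, ∃ v, j v < I + 1 / ((n : ℝ) + 1) := fun n =>
    exists_lt_of_ciInf_lt (by rw [← hI]; linarith [Nat.one_div_pos_of_nat (α := ℝ) (n := n)])
  choose w hw using hex
  -- Near-minimizers are close to each other: this yields the Cauchy property of a minimizing
  -- sequence and, with `δ = 0`, uniqueness.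
  have hdist : ∀ u v δ, j u ≤ I + δ → j v ≤ I + δ → κ * ‖u - v‖ ^ 2 ≤ δ := by
    intro u v δ hu hv
    linarith [hc u v, hIle ((1 / 2 : ℝ) • (u + v))]
  have hcau : CauchySeq w := by
    rw [Metric.cauchySeq_iff']
    intro r hr
    obtain ⟨n, hn⟩ := exists_nat_one_div_lt (show 0 < κ * r ^ 2 by positivity)
    refine ⟨n, fun k hk => ?_⟩
    have h1 : κ * ‖w k - w n‖ ^ 2 ≤ 1 / ((n : ℝ) + 1) := by
      refine hdist _ _ _ ((hw k).le.trans ?_) (hw n).le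
      have := Nat.one_div_le_one_div (α := ℝ) hk
      linarith
    rw [dist_eq_norm]
    have h2 : κ * ‖w k - w n‖ ^ 2 < κ * r ^ 2 := h1.trans_lt hn
    exact lt_of_pow_lt_pow_left₀ 2 hr.le (lt_of_mul_lt_mul_left h2 hκ.le)
  obtain ⟨u, hu⟩ := cauchySeq_tendsto_of_complete hcau
  have hju : j u ≤ I := by
    have h1 : Tendsto (fun n => j (w n)) atTop (𝓝 (j u)) := (hj.tendsto u).comp hu
    have h2 : Tendsto (fun n : ℕ => I + 1 / ((n : ℝ) + 1)) atTop (𝓝 (I + 0)) :=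
      tendsto_const_nhds.add tendsto_one_div_add_atTop_nhds_zero_nat
    simpa using le_of_tendsto_of_tendsto' h1 h2 fun n => (hw n).le
  refine ⟨u, fun v => hju.trans (hIle v), fun v hv => ?_⟩
  have h := hdist v u 0 (by linarith [hv u]) (by linarith)
  have : ‖v - u‖ ^ 2 ≤ 0 := by nlinarith [sq_nonneg ‖v - u‖]
  have : ‖v - u‖ = 0 := by nlinarith [norm_nonneg (v - u)]
  exact sub_eq_zero.mp (norm_eq_zero.mp this)

/-! ### The space `H¹₀`: Poincaré inequality and du Bois-Reymond lemma. -/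

section H10

variable {m : ℕ} {T : ℝ}

instance : IsFiniteMeasure (leb T) := ⟨by simp [leb]⟩

/-- `v ↦ v` as a continuous linear map from `H¹₀` to `L²`. -/
def fnL (m : ℕ) (T : ℝ) : H10 m T →L[ℝ] L2 m T :=
  (WithLp.fstL 2 ℝ (L2 m T) (L2 m T)).comp (testPairs m T).topologicalClosure.subtypeL

/-- `v ↦ v'` as a continuous linear map from `H¹₀` to `L²`. -/
def derL (m : ℕ) (T : ℝ) : H10 m T →L[ℝ] L2 m T :=
  (WithLp.sndL 2 ℝ (L2 m T) (L2 m T)).comp (testPairs m T).topologicalClosure.subtypeL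

theorem H10.fn_eq (v : H10 m T) : v.fn = fnL m T v := rfl

theorem H10.der_eq (v : H10 m T) : v.der = derL m T v := rfl

theorem H10.norm_sq (v : H10 m T) : ‖v‖ ^ 2 = ‖fnL m T v‖ ^ 2 + ‖derL m T v‖ ^ 2 :=
  WithLp.prod_norm_sq_eq_of_L2 (v : WithLp 2 (L2 m T × L2 m T))

theorem IsTest.memLp {φ : ℝ → Vec m} (h : IsTest m T φ) : MemLp φ 2 (leb T) :=
  (h.smooth.continuous.memLp_of_hasCompactSupport h.compact)

theorem IsTest.continuous_deriv {φ : ℝ → Vec m} (h : IsTest m T φ) : Continuous (deriv φ) :=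
  h.smooth.continuous_deriv (by simp)

theorem IsTest.memLp_deriv {φ : ℝ → Vec m} (h : IsTest m T φ) : MemLp (deriv φ) 2 (leb T) :=
  h.continuous_deriv.memLp_of_hasCompactSupport h.compact.deriv

/-- A test function as an element of `H¹₀`. -/
def IsTest.toH10 {φ : ℝ → Vec m} (h : IsTest m T φ) : H10 m T :=
  ⟨WithLp.toLp 2 (h.memLp.toLp φ, h.memLp_deriv.toLp (deriv φ)),
    (testPairs m T).le_topologicalClosure
      ⟨φ, h, h.memLp.coeFn_toLp, h.memLp_deriv.coeFn_toLp⟩⟩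

theorem IsTest.der_toH10 {φ : ℝ → Vec m} (h : IsTest m T φ) :
    (derL m T h.toH10 : ℝ → Vec m) =ᵐ[leb T] deriv φ :=
  h.memLp_deriv.coeFn_toLp

theorem integral_norm_le (hT : 0 ≤ T) (f : L2 m T) : ∫ t, ‖f t‖ ∂leb T ≤ √T * ‖f‖ := by
  have h := eLpNorm_le_eLpNorm_mul_rpow_measure_univ (μ := leb T) (p := 1) (q := 2) (by norm_num)
    (Lp.aestronglyMeasurable f)
  rw [integral_norm_eq_lintegral_enorm (Lp.aestronglyMeasurable f), ← eLpNorm_one_eq_lintegral_enorm,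
    Lp.norm_def]
  have h2 : (leb T univ) ^ (1 / (1 : ENNReal).toReal - 1 / (2 : ENNReal).toReal)
      = ENNReal.ofReal √T := by
    simp only [leb, Measure.restrict_apply_univ, Real.volume_Ioo, sub_zero, Real.sqrt_eq_rpow]
    rw [ENNReal.ofReal_rpow_of_nonneg hT (by norm_num)]
    norm_num
  rw [h2] at h
  have h3 := ENNReal.toReal_mono (ENNReal.mul_ne_top (Lp.eLpNorm_ne_top f) ENNReal.ofReal_ne_top) h
  rw [ENNReal.toReal_mul, ENNReal.toReal_ofReal (Real.sqrt_nonneg _)] at h3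
  linarith

theorem L2.norm_sq_eq (f : L2 m T) : ‖f‖ ^ 2 = ∫ t, ‖f t‖ ^ 2 ∂leb T := by
  rw [← real_inner_self_eq_norm_sq, MeasureTheory.L2.inner_def]
  simp

theorem L2.integrable_norm_sq (f : L2 m T) : Integrable (fun t => ‖f t‖ ^ 2) (leb T) :=
  (Lp.memLp f).integrable_norm_pow (by norm_num)

theorem L2.integrable (f : L2 m T) : Integrable f (leb T) :=
  (Lp.memLp f).integrable (by norm_num)

theorem integral_leb_eq (hT : 0 ≤ T) {E : Type*} [NormedAddCommGroup E] [NormedSpace ℝ E]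
    (f : ℝ → E) : ∫ t, f t ∂leb T = ∫ t in (0 : ℝ)..T, f t := by
  rw [intervalIntegral.integral_of_le hT, integral_Ioc_eq_integral_Ioo]

/-- The inequality is a closed condition, so test functions suffice. For these `|φ(t)| ≤ ∫ |φ'| ≤ √T
‖φ'‖`, and integrating the square over an interval of length `T` gives the factor `T`. -/
theorem poincare (hT : 0 ≤ T) (v : H10 m T) : ‖fnL m T v‖ ≤ T * ‖derL m T v‖ := by
  obtain ⟨w, hw⟩ := v
  change ‖w.fst‖ ≤ T * ‖w.snd‖
  have hcl : IsClosed {w : WithLp 2 (L2 m T × L2 m T) | ‖w.fst‖ ≤ T * ‖w.snd‖} :=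
    isClosed_le (WithLp.fstL 2 ℝ (L2 m T) (L2 m T)).continuous.norm
      (continuous_const.mul (WithLp.sndL 2 ℝ (L2 m T) (L2 m T)).continuous.norm)
  refine closure_minimal ?_ hcl hw
  rintro w ⟨φ, hφ, h1, h2⟩
  have hpt : ∀ t ∈ Ioo 0 T, ‖φ t‖ ≤ √T * ‖w.snd‖ := by
    intro t ht
    have h0 : φ 0 = 0 := image_eq_zero_of_notMem_tsupport fun h => by simpa using hφ.support h
    have hint : ∫ s in (0 : ℝ)..t, deriv φ s = φ t := by
      rw [intervalIntegral.integral_deriv_eq_sub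
        (fun s _ => hφ.smooth.differentiable (by simp) s)
        (hφ.continuous_deriv.intervalIntegrable _ _), h0, sub_zero]
    rw [← hint]
    refine le_trans ?_ (integral_norm_le hT w.snd)
    have e : ∫ s, ‖w.snd s‖ ∂leb T = ∫ s in Ioo 0 T, ‖deriv φ s‖ :=
      integral_congr_ae (h2.fun_comp norm)
    rw [e]
    refine (intervalIntegral.norm_integral_le_integral_norm ht.1.le).trans ?_
    rw [intervalIntegral.integral_of_le ht.1.le]
    refine setIntegral_mono_set ?_ (Eventually.of_forall fun s => norm_nonneg _) ?_
    · exact (hφ.memLp_deriv.integrable (by norm_num)).norm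
    · exact (show Ioc 0 t ⊆ Ioo 0 T from fun s hs => ⟨hs.1, hs.2.trans_lt ht.2⟩).eventuallyLE
  have hsq : ‖w.fst‖ ^ 2 ≤ (T * ‖w.snd‖) ^ 2 := by
    rw [L2.norm_sq_eq]
    calc ∫ t, ‖w.fst t‖ ^ 2 ∂leb T ≤ ∫ t, (√T * ‖w.snd‖) ^ 2 ∂leb T := by
          refine integral_mono_ae (L2.integrable_norm_sq _) (integrable_const _) ?_
          filter_upwards [h1, ae_restrict_mem measurableSet_Ioo] with t ht hmem
          rw [ht]
          exact pow_le_pow_left₀ (norm_nonneg _) (hpt t hmem) 2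
      _ = (T * ‖w.snd‖) ^ 2 := by
          rw [integral_const]
          simp only [leb, measureReal_restrict_apply_univ, Real.volume_real_Ioo_of_le hT, sub_zero,
            smul_eq_mul, mul_pow, Real.sq_sqrt hT]
          ring
  exact le_of_sq_le_sq hsq (by positivity)

theorem norm_le_der (hT : 0 ≤ T) (v : H10 m T) : ‖v‖ ^ 2 ≤ (T ^ 2 + 1) * ‖derL m T v‖ ^ 2 := by
  have := pow_le_pow_left₀ (norm_nonneg _) (poincare hT v) 2
  rw [H10.norm_sq]
  nlinarith

/-- Zero mean is what makes the primitive vanish again to the right of the support. This supplies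
the test functions for du Bois-Reymond. -/
theorem isTest_primitive {h : ℝ → ℝ} (hs : ContDiff ℝ ((⊤ : ℕ∞) : WithTop ℕ∞) h)
    (hc : HasCompactSupport h) (hsup : tsupport h ⊆ Ioo 0 T) (h0 : ∫ t, h t ∂leb T = 0)
    (hT : 0 < T) (e : Vec m) :
    IsTest m T (fun t => (∫ s in (0 : ℝ)..t, h s) • e) ∧
      deriv (fun t => (∫ s in (0 : ℝ)..t, h s) • e) = fun t => h t • e := by
  have hder : ∀ t, HasDerivAt (fun t => (∫ s in (0 : ℝ)..t, h s) • e) (h t • e) t := fun t =>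
    (intervalIntegral.integral_hasDerivAt_right (hs.continuous.intervalIntegrable _ _)
      (hs.continuous.stronglyMeasurableAtFilter _ _) hs.continuous.continuousAt).smul_const e
  have hd : deriv (fun t => (∫ s in (0 : ℝ)..t, h s) • e) = fun t => h t • e :=
    funext fun t => (hder t).deriv
  obtain ⟨a, b, ha, hb, hab⟩ : ∃ a b : ℝ, 0 < a ∧ b < T ∧ tsupport h ⊆ Icc a b := by
    rcases (tsupport h).eq_empty_or_nonempty with he | hne
    -- With `a = T` and `b = 0` the interval `Icc a b` is empty.
    · exact ⟨T, 0, hT, hT, by simp [he]⟩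
    · obtain ⟨a, ha⟩ := hc.isCompact.exists_isLeast hne
      obtain ⟨b, hb⟩ := hc.isCompact.exists_isGreatest hne
      exact ⟨a, b, (hsup ha.1).1, (hsup hb.1).2, fun t ht => ⟨ha.2 ht, hb.2 ht⟩⟩
  have hz : ∀ s, s ∉ Icc a b → h s = 0 := fun s hs => image_eq_zero_of_notMem_tsupport fun h' =>
    hs (hab h')
  have hsupp : Function.support (fun t => (∫ s in (0 : ℝ)..t, h s) • e) ⊆ Icc a b := by
    intro t ht
    by_contra hn
    refine ht ?_
    have : ∫ s in (0 : ℝ)..t, h s = 0 := by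
      rcases lt_or_ge t a with hta | hta
      · refine (intervalIntegral.integral_congr fun s hs => hz s fun hs' => ?_).trans
          intervalIntegral.integral_zero
        linarith [hs'.1, hs.2.trans_lt (max_lt ha hta)]
      · have htb : b < t := by by_contra h'; exact hn ⟨hta, not_lt.mp h'⟩
        rw [integral_leb_eq hT.le] at h0
        rw [← intervalIntegral.integral_add_adjacent_intervals (b := T)
          (hs.continuous.intervalIntegrable _ _) (hs.continuous.intervalIntegrable _ _), h0, zero_add]
        refine (intervalIntegral.integral_congr fun s hs => hz s fun hs' => ?_).trans
          intervalIntegral.integral_zero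
        linarith [hs'.2, (lt_min hb htb).trans_le hs.1]
    simp [this]
  have hts : tsupport (fun t => (∫ s in (0 : ℝ)..t, h s) • e) ⊆ Icc a b :=
    closure_minimal hsupp isClosed_Icc
  refine ⟨⟨?_, ?_, hts.trans fun t ht => ⟨ha.trans_le ht.1, ht.2.trans_lt hb⟩⟩, hd⟩
  · refine contDiff_infty_iff_deriv.2 ⟨fun t => (hder t).differentiableAt, ?_⟩
    rw [hd]
    exact hs.smul contDiff_const
  · exact isCompact_Icc.of_isClosed_subset (isClosed_tsupport _) hts

/-- du Bois-Reymond: an `L²` function orthogonal to all derivatives is constant. -/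
theorem ae_eq_const_of_inner_der (hT : 0 < T) (f : L2 m T)
    (hf : ∀ v : H10 m T, inner ℝ f (derL m T v) = 0) :
    ∃ c : Vec m, (f : ℝ → Vec m) =ᵐ[leb T] fun _ => c := by
  obtain ⟨ψ, hψs, hψc, hψt, hψ1⟩ : ∃ ψ : ℝ → ℝ, ContDiff ℝ ((⊤ : ℕ∞) : WithTop ℕ∞) ψ ∧
      HasCompactSupport ψ ∧ tsupport ψ ⊆ Ioo 0 T ∧ ∫ t, ψ t ∂leb T = 1 := by
    let β : ContDiffBump (T / 2) := ⟨T / 8, T / 4, by linarith, by linarith⟩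
    have ht : tsupport (β.normed volume) ⊆ Ioo 0 T := by
      rw [β.tsupport_normed_eq, Real.closedBall_eq_Icc]
      intro t ht
      have h1 := ht.1
      have h2 := ht.2
      simp only [β] at h1 h2
      constructor <;> linarith
    refine ⟨β.normed volume, β.contDiff_normed, β.hasCompactSupport_normed, ht, ?_⟩
    rw [leb, setIntegral_eq_integral_of_forall_compl_eq_zero, β.integral_normed]
    exact fun t hn => image_eq_zero_of_notMem_tsupport fun h' => hn (ht h')
  have hint : ∀ g : ℝ → ℝ, Continuous g → HasCompactSupport g →
      Integrable (fun t => g t • f t) (leb T) := by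
    intro g hg hgc
    obtain ⟨C, hC⟩ := hg.bounded_above_of_compact_support hgc
    exact (L2.integrable f).bdd_smul C hg.aestronglyMeasurable (Eventually.of_forall hC)
  -- A constant equals its mean against `ψ`, so this is the only candidate. For a test function `g`,
  -- the function `g - (∫ g) ψ` has zero mean and is the derivative of a test function;
  -- orthogonality of `f` to it says that `∫ g (f - c) = 0`.
  refine ⟨∫ t, ψ t • f t ∂leb T, ?_⟩
  set c := ∫ t, ψ t • f t ∂leb T with hc
  have key : ∀ᵐ t ∂leb T, t ∈ Ioo 0 T → f t - c = 0 := by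
    refine isOpen_Ioo.ae_eq_zero_of_integral_contDiff_smul_eq_zero
      (((L2.integrable f).sub (integrable_const c)).locallyIntegrable.locallyIntegrableOn _) ?_
    intro g hg hgc hgt
    have hgi : Integrable g (leb T) := hg.continuous.integrable_of_hasCompactSupport hgc
    have hψi : Integrable ψ (leb T) := hψs.continuous.integrable_of_hasCompactSupport hψc
    set I := ∫ t, g t ∂leb T with hI
    have hgf := hint g hg.continuous hgc
    have hψf := hint ψ hψs.continuous hψc
    have hval : ∫ t, g t • (f t - c) ∂leb T = ∫ t, (g t - I * ψ t) • f t ∂leb T := by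
      simp only [smul_sub, sub_smul, mul_smul]
      rw [integral_sub hgf (hgi.smul_const c), integral_smul_const,
        integral_sub (g := fun t => I • ψ t • f t) hgf (hψf.smul I), integral_smul]
    rw [hval]
    have hh : Integrable (fun t => (g t - I * ψ t) • f t) (leb T) := by
      simp only [sub_smul, mul_smul]
      exact hgf.sub (hψf.smul I)
    refine ext_inner_right ℝ fun e => ?_
    rw [inner_zero_left, real_inner_comm, ← integral_inner hh]
    have hprim := isTest_primitive (m := m) (T := T) (h := fun t => g t - I * ψ t)
      (hg.sub (contDiff_const.mul hψs)) (hgc.sub (hψc.mul_left))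
      ((tsupport_sub _ _).trans (union_subset hgt ((tsupport_mul_subset_right).trans hψt)))
      (by rw [integral_sub hgi (hψi.const_mul I), integral_const_mul, hψ1, ← hI]; ring) hT e
    have h := hf hprim.1.toH10
    rw [MeasureTheory.L2.inner_def] at h
    rw [← h]
    refine integral_congr_ae ?_
    filter_upwards [hprim.1.der_toH10] with t ht
    rw [ht, hprim.2, inner_smul_right, inner_smul_right, real_inner_comm]
  filter_upwards [key, ae_restrict_mem measurableSet_Ioo] with t h1 h2
  exact sub_eq_zero.mp (h1 h2)

end H10

/-! ### Integration by parts and linear differential equations. -/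

section ODE

/-- Integration by parts of a `C¹` function against a primitive of an integrable function. -/
theorem integral_mul_primitive {T : ℝ} (hT : 0 ≤ T) {q q' f F : ℝ → ℝ}
    (hq : ∀ t ∈ Icc 0 T, HasDerivWithinAt q (q' t) (Icc 0 T) t) (hq' : ContinuousOn q' (Icc 0 T))
    (hf : IntervalIntegrable f volume 0 T) (hF : ∀ t ∈ Icc 0 T, F t = ∫ s in (0 : ℝ)..t, f s) :
    ∫ t in (0 : ℝ)..T, q t * f t = q T * F T - ∫ t in (0 : ℝ)..T, q' t * F t := by
  have hu : uIcc 0 T = Icc 0 T := uIcc_of_le hT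
  obtain ⟨C, hC⟩ := isCompact_Icc.exists_bound_of_continuousOn hq'
  -- `F` is differentiable only almost everywhere, so the formula used is that for absolutely
  -- continuous functions; `q` qualifies because its bounded derivative makes it Lipschitz.
  have hqac : AbsolutelyContinuousOnInterval q 0 T := by
    refine LipschitzOnWith.absolutelyContinuousOnInterval (K := C.toNNReal) ?_
    rw [hu]
    exact (convex_Icc 0 T).lipschitzOnWith_of_nnnorm_hasDerivWithin_le hq fun t ht => by
      rw [← NNReal.coe_le_coe, coe_nnnorm]
      exact (hC t ht).trans (Real.le_coe_toNNReal C)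
  have hgac := hf.absolutelyContinuousOnInterval_intervalIntegral (c := 0) left_mem_uIcc
  have h := hqac.integral_mul_deriv_eq_deriv_mul hgac
  have hmem : ∀ t, t ∈ uIoc 0 T → t ∈ Icc 0 T := fun t ht => hu ▸ uIoc_subset_uIcc ht
  have h1 : ∫ t in (0 : ℝ)..T, q t * deriv (fun x => ∫ v in (0 : ℝ)..x, f v) t =
      ∫ t in (0 : ℝ)..T, q t * f t := by
    refine intervalIntegral.integral_congr_ae ?_
    filter_upwards [hf.ae_hasDerivAt_integral] with t ht hmem
    rw [(ht (uIoc_subset_uIcc hmem) 0 left_mem_uIcc).deriv]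
  have h2 : ∫ t in (0 : ℝ)..T, deriv q t * (∫ v in (0 : ℝ)..t, f v) =
      ∫ t in (0 : ℝ)..T, q' t * F t := by
    refine intervalIntegral.integral_congr_ae ?_
    -- The endpoint `T` is discarded because a derivative within `[0,T]` is a derivative only at
    -- interior points.
    filter_upwards [compl_mem_ae_iff.2 (measure_singleton T)] with t hne ht
    have ht' := hmem t ht
    rw [uIoc_of_le hT] at ht
    have hio : Icc 0 T ∈ 𝓝 t := Icc_mem_nhds ht.1 (lt_of_le_of_ne ht.2 hne)
    rw [((hq t ht').hasDerivAt hio).deriv, hF t ht']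
  rw [h1, h2] at h
  rw [h, hF T ⟨hT, le_rfl⟩]
  simp

theorem integral_inner_primitive {T : ℝ} (hT : 0 ≤ T) {n : ℕ} {q q' f F : ℝ → Vec n}
    (hq : ∀ t ∈ Icc 0 T, HasDerivWithinAt q (q' t) (Icc 0 T) t) (hq' : ContinuousOn q' (Icc 0 T))
    (hf : IntervalIntegrable f volume 0 T) (hF : ∀ t ∈ Icc 0 T, F t = ∫ s in (0 : ℝ)..t, f s) :
    ∫ t in (0 : ℝ)..T, inner ℝ (q t) (f t) =
      inner ℝ (q T) (F T) - ∫ t in (0 : ℝ)..T, inner ℝ (q' t) (F t) := by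
  have hu : uIcc 0 T = Icc 0 T := uIcc_of_le hT
  have hqc : ContinuousOn q (Icc 0 T) := fun t ht => (hq t ht).continuousWithinAt
  have hFc : ContinuousOn F (Icc 0 T) := by
    have := intervalIntegral.continuousOn_primitive_interval' hf left_mem_uIcc
    rw [hu] at this
    exact this.congr hF
  have hcoord : ∀ i : Fin n, ∀ g : ℝ → Vec n, IntervalIntegrable g volume 0 T →
      IntervalIntegrable (fun t => g t i) volume 0 T := fun i g hg =>
    ⟨(EuclideanSpace.proj (𝕜 := ℝ) i).integrable_comp hg.1,
      (EuclideanSpace.proj (𝕜 := ℝ) i).integrable_comp hg.2⟩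
  have hproj : ∀ i : Fin n, Continuous fun x : Vec n => x i := fun i =>
    (EuclideanSpace.proj (𝕜 := ℝ) i).continuous
  have hi := fun i : Fin n => integral_mul_primitive hT
    (q := fun t => q t i) (q' := fun t => q' t i) (f := fun t => f t i) (F := fun t => F t i)
    (fun t ht => ((EuclideanSpace.proj (𝕜 := ℝ) i).hasFDerivAt.comp_hasDerivWithinAt t (hq t ht)))
    ((hproj i).comp_continuousOn hq') (hcoord i f hf)
    (fun t ht => by
      rw [hF t ht]
      have hft : IntervalIntegrable f volume 0 t := hf.mono_set (by
        rw [hu, uIcc_of_le ht.1]; exact Icc_subset_Icc_right ht.2)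
      exact ((EuclideanSpace.proj (𝕜 := ℝ) i).intervalIntegral_comp_comm hft).symm)
  simp only [PiLp.inner_apply, RCLike.inner_apply, conj_trivial]
  rw [intervalIntegral.integral_finsetSum, intervalIntegral.integral_finsetSum,
    ← Finset.sum_sub_distrib]
  · refine Finset.sum_congr rfl fun i _ => ?_
    have := hi i
    simp only [mul_comm] at this ⊢
    exact this
  · intro i _
    refine ContinuousOn.intervalIntegrable ?_
    rw [hu]
    exact ((hproj i).comp_continuousOn hFc).mul ((hproj i).comp_continuousOn hq')
  · intro i _
    refine (hcoord i f hf).mul_continuousOn ?_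
    rw [hu]
    exact (hproj i).comp_continuousOn hqc

variable {E : Type*} [NormedAddCommGroup E] [NormedSpace ℝ E] [CompleteSpace E]

/-- Since `f` is merely integrable, `Z` need not be differentiable. Its primitive `G` is split off:
`Y = Z - G` solves `Y' = A(Y + G)`, whose right-hand side is continuous, and variation of constants
applies. -/
theorem exists_linear_ode_integral (A : E →L[ℝ] E) {f : ℝ → E} (hf : Integrable f) (z₀ : E) :
    ∃ Z : ℝ → E, Continuous Z ∧ ∀ t, Z t = z₀ + ∫ s in (0 : ℝ)..t, (A (Z s) + f s) := by
  set G : ℝ → E := fun t => ∫ s in (0 : ℝ)..t, f s with hG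
  have hGc : Continuous G := intervalIntegral.continuous_primitive (fun _ _ => hf.intervalIntegrable) 0
  set U : ℝ → E →L[ℝ] E := fun t => NormedSpace.exp (t • A) with hU
  have hUd : ∀ t, HasDerivAt U (A * U t) t := fun t => hasDerivAt_exp_smul_const' A t
  have hUc : Continuous U := continuous_iff_continuousAt.2 fun t => (hUd t).continuousAt
  have hinv : ∀ t, U t * U (-t) = 1 := fun t => by
    simp only [hU]
    let _ : NormedAlgebra ℚ (E →L[ℝ] E) := NormedAlgebra.restrictScalars ℚ ℝ _
    rw [neg_smul, ← NormedSpace.exp_add_of_commute ((Commute.refl _).neg_right), add_neg_cancel,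
      NormedSpace.exp_zero]
  set I : ℝ → E := fun t => ∫ s in (0 : ℝ)..t, U (-s) (A (G s)) with hI
  have hIc : Continuous fun s => U (-s) (A (G s)) :=
    (hUc.comp continuous_neg).clm_apply (A.continuous.comp hGc)
  have hId : ∀ t, HasDerivAt I (U (-t) (A (G t))) t := fun t =>
    intervalIntegral.integral_hasDerivAt_right (hIc.intervalIntegrable _ _)
      (hIc.stronglyMeasurableAtFilter _ _) hIc.continuousAt
  set Y : ℝ → E := fun t => U t (z₀ + I t) with hY
  have hYd : ∀ t, HasDerivAt Y (A (Y t + G t)) t := fun t => by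
    have h := (hUd t).clm_apply ((hId t).const_add z₀)
    convert! h using 1
    have h2 : U t (U (-t) (A (G t))) = A (G t) := by
      rw [← mul_apply_eq_comp, hinv]; rfl
    rw [h2, map_add]
    rfl
  have hYc : Continuous Y := continuous_iff_continuousAt.2 fun t => (hYd t).continuousAt
  have hc : Continuous fun t => A (Y t + G t) := A.continuous.comp (hYc.add hGc)
  refine ⟨fun t => Y t + G t, hYc.add hGc, fun t => ?_⟩
  rw [intervalIntegral.integral_add (hc.intervalIntegrable _ _) hf.intervalIntegrable,
    intervalIntegral.integral_eq_sub_of_hasDerivAt (fun s _ => hYd s) (hc.intervalIntegrable _ _)]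
  have : Y 0 = z₀ := by simp [hY, hI, hU, NormedSpace.exp_zero]
  rw [this]
  simp only [hG]
  abel

theorem exists_linear_ode_terminal (A : E →L[ℝ] E) (T : ℝ) (z : E) :
    ∃ Z : ℝ → E, (∀ t, HasDerivAt Z (A (Z t)) t) ∧ Z T = z := by
  refine ⟨fun t => NormedSpace.exp ((t - T) • A) z, fun t => ?_, by simp [NormedSpace.exp_zero]⟩
  have h := (hasDerivAt_exp_smul_const' (𝕂 := ℝ) A (t - T)).comp_sub_const t T
  simpa using h.clm_apply (hasDerivAt_const t z)

end ODE

/-! ### State, adjoint state and the duality between them. -/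

/-- A matrix as a continuous linear map between Euclidean spaces. -/
def actL {m n : ℕ} (A : Matrix (Fin m) (Fin n) ℝ) : Vec n →L[ℝ] Vec m :=
  LinearMap.toContinuousLinearMap
    { toFun := act A
      map_add' := fun x y => by simp [act, Matrix.mulVec_add]
      map_smul' := fun c x => by simp [act, Matrix.mulVec_smul] }

theorem actL_apply {m n : ℕ} (A : Matrix (Fin m) (Fin n) ℝ) (x : Vec n) : actL A x = act A x := rfl

theorem inner_act {m n : ℕ} (A : Matrix (Fin m) (Fin n) ℝ) (x : Vec n) (y : Vec m) :
    inner ℝ (act A x) y = inner ℝ x (act A.transpose y) := by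
  simp only [act, EuclideanSpace.inner_eq_star_dotProduct, star_trivial]
  rw [Matrix.dotProduct_mulVec, Matrix.mulVec_transpose]

theorem act_act_inv {n : ℕ} {M : Matrix (Fin n) (Fin n) ℝ} (hM : M.PosDef) (x : Vec n) :
    act M (act M⁻¹ x) = x := by
  have : IsUnit M.det := hM.det_pos.ne'.isUnit
  simp [act, Matrix.mulVec_mulVec, Matrix.mul_nonsing_inv _ this]

theorem transpose_eq {n : ℕ} {M : Matrix (Fin n) (Fin n) ℝ} (hM : M.PosDef) :
    M.transpose = M := by
  have := hM.isHermitian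
  rwa [Matrix.IsHermitian, Matrix.conjTranspose_eq_transpose_of_trivial] at this

namespace Data

variable {N p : ℕ} (D : Data N p)

/-- As `M` is invertible, the equation is a first-order system for `(X, V)` with forcing `(0, M⁻¹(F
+ Bu))`, extended by zero outside `]0,T[`. -/
theorem exists_isState (hD : D.Admissible) (u : L2 p D.T) : ∃ X V, D.IsState u X V := by
  have hT := hD.T_pos.le
  let g : L2 N D.T := (actL D.M⁻¹).compLp (D.F + (actL D.B).compLp u)
  let f : ℝ → Vec N × Vec N := (Ioo 0 D.T).indicator fun t => (0, g t)
  have hf : Integrable f := by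
    refine (integrable_indicator_iff measurableSet_Ioo).2 ?_
    exact (integrable_zero _ _ _).prodMk (L2.integrable g)
  let A : (Vec N × Vec N) →L[ℝ] (Vec N × Vec N) :=
    (ContinuousLinearMap.snd ℝ _ _).prod
      (-((actL D.M⁻¹).comp ((actL D.C).comp (ContinuousLinearMap.snd ℝ _ _) +
        (actL D.K).comp (ContinuousLinearMap.fst ℝ _ _))))
  obtain ⟨Z, hZc, hZ⟩ := exists_linear_ode_integral A hf (D.X₀, D.X₁)
  -- The acceleration is the sum of this continuous part and of the `L²` part `g`.
  let a : ℝ → Vec N := fun t => -act D.M⁻¹ (act D.C (Z t).2 + act D.K (Z t).1)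
  have hac : Continuous a := by
    have : Continuous fun t => A (Z t) := A.continuous.comp hZc
    exact continuous_snd.comp this
  have ham : MemLp a 2 (leb D.T) := by
    obtain ⟨C, hC⟩ := isCompact_Icc.exists_bound_of_continuousOn (hac.continuousOn (s := Icc 0 D.T))
    refine MemLp.of_bound hac.aestronglyMeasurable C ?_
    filter_upwards [ae_restrict_mem measurableSet_Ioo] with t ht
    exact hC t (Ioo_subset_Icc_self ht)
  have hA := Lp.coeFn_add (ham.toLp a) g
  have hi : ∀ t, IntervalIntegrable (fun s => A (Z s) + f s) volume 0 t := fun t =>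
    ((A.continuous.comp hZc).intervalIntegrable _ _).add hf.intervalIntegrable
  refine ⟨fun t => (Z t).1, fun t => (Z t).2, ham.toLp a + g, fun t ht => ?_, fun t ht => ?_, ?_⟩
  · have h := congrArg Prod.fst (hZ t)
    refine h.trans (congrArg (D.X₀ + ·) ?_)
    refine ((ContinuousLinearMap.fst ℝ (Vec N) (Vec N)).intervalIntegral_comp_comm (hi t)).symm.trans ?_
    refine intervalIntegral.integral_congr fun s hs => ?_
    have : (f s).1 = 0 := by
      by_cases hs : s ∈ Ioo 0 D.T <;> simp [f, hs]
    simp [A, this]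
  · have h := congrArg Prod.snd (hZ t)
    refine h.trans (congrArg (D.X₁ + ·) ?_)
    refine ((ContinuousLinearMap.snd ℝ (Vec N) (Vec N)).intervalIntegral_comp_comm (hi t)).symm.trans ?_
    rw [intervalIntegral.integral_of_le ht.1, intervalIntegral.integral_of_le ht.1,
      integral_Ioc_eq_integral_Ioo, integral_Ioc_eq_integral_Ioo]
    have hsub : Ioo 0 t ⊆ Ioo 0 D.T := Ioo_subset_Ioo_right ht.2
    refine integral_congr_ae ?_
    filter_upwards [ae_restrict_of_ae_restrict_of_subset hsub hA,
      ae_restrict_of_ae_restrict_of_subset hsub ham.coeFn_toLp,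
      ae_restrict_mem measurableSet_Ioo] with s h1 h2 h3
    rw [h1, Pi.add_apply, h2]
    have e : f s = (0, g s) := indicator_of_mem (hsub h3) _
    rw [e]
    rfl
  · filter_upwards [hA, ham.coeFn_toLp, (actL D.M⁻¹).coeFn_compLp (D.F + (actL D.B).compLp u),
      Lp.coeFn_add D.F ((actL D.B).compLp u), (actL D.B).coeFn_compLp u] with t h1 h2 h3 h4 h5
    rw [h1, Pi.add_apply, h2, h3, h4, Pi.add_apply, h5]
    simp only [← actL_apply, map_add]
    simp only [a, map_neg, actL_apply, act_act_inv hD.M_posDef]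
    abel

/-- The final data are arbitrary, not only those of an optimal state: `exists_representative` needs
every linear functional of the final state. -/
theorem exists_adjoint (hD : D.Admissible) (x v : Vec N) : ∃ P P' P'' : ℝ → Vec N,
    (∀ t ∈ Icc 0 D.T, HasDerivWithinAt P (P' t) (Icc 0 D.T) t) ∧
    (∀ t ∈ Icc 0 D.T, HasDerivWithinAt P' (P'' t) (Icc 0 D.T) t) ∧
    (∀ t ∈ Icc 0 D.T,
      act D.M (P'' t) - act D.C.transpose (P' t) + act D.K.transpose (P t) = 0) ∧
    act D.M (P D.T) = v ∧
    act D.M (P' D.T) = -x + act D.C.transpose (P D.T) := by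
  let A : (Vec N × Vec N) →L[ℝ] (Vec N × Vec N) :=
    (ContinuousLinearMap.snd ℝ _ _).prod
      ((actL D.M⁻¹).comp ((actL D.C.transpose).comp (ContinuousLinearMap.snd ℝ _ _) -
        (actL D.K.transpose).comp (ContinuousLinearMap.fst ℝ _ _)))
  obtain ⟨Z, hZ, hZT⟩ := exists_linear_ode_terminal A D.T
    (act D.M⁻¹ v, act D.M⁻¹ (-x + act D.C.transpose (act D.M⁻¹ v)))
  refine ⟨fun t => (Z t).1, fun t => (Z t).2, fun t => (A (Z t)).2, fun t _ => ?_, fun t _ => ?_,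
    fun t _ => ?_, ?_, ?_⟩
  · exact ((ContinuousLinearMap.fst ℝ _ _).hasFDerivAt.comp_hasDerivAt t (hZ t)).hasDerivWithinAt
  · exact ((ContinuousLinearMap.snd ℝ _ _).hasFDerivAt.comp_hasDerivAt t (hZ t)).hasDerivWithinAt
  · simp only [A, ContinuousLinearMap.prod_apply, ContinuousLinearMap.comp_apply,
      sub_apply, actL_apply, ContinuousLinearMap.coe_snd',
      ContinuousLinearMap.coe_fst']
    rw [act_act_inv hD.M_posDef]
    abel
  · simp only [hZT]; exact act_act_inv hD.M_posDef _
  · simp only [hZT]; exact act_act_inv hD.M_posDef _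

theorem IsState.continuousOn {D : Data N p} (hT : 0 ≤ D.T) {u : L2 p D.T} {X V : ℝ → Vec N}
    (h : D.IsState u X V) : ContinuousOn X (Icc 0 D.T) ∧ ContinuousOn V (Icc 0 D.T) := by
  obtain ⟨A, hX, hV, -⟩ := h
  have hu : uIcc 0 D.T = Icc 0 D.T := uIcc_of_le hT
  have hA : IntervalIntegrable A volume 0 D.T := by
    rw [intervalIntegrable_iff_integrableOn_Ioo_of_le hT]
    exact L2.integrable A
  have hVc : ContinuousOn V (Icc 0 D.T) := by
    have := (intervalIntegral.continuousOn_primitive_interval' hA left_mem_uIcc).const_add D.X₁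
    rw [hu] at this
    exact this.congr hV
  refine ⟨?_, hVc⟩
  have hVi : IntervalIntegrable V volume 0 D.T := by
    refine ContinuousOn.intervalIntegrable ?_
    rwa [hu]
  have := (intervalIntegral.continuousOn_primitive_interval' hVi left_mem_uIcc).const_add D.X₀
  rw [hu] at this
  exact this.congr hX

/-- The difference of two states has zero initial data and right-hand side `B(u - v)`. Its
acceleration is integrated by parts against `MP`, and its velocity against `Q = ᵗCP - MP'`, for
which the adjoint equation reads `Q' = ᵗKP`. Only the boundary terms at `T` survive. -/
theorem adjoint_pairing (hD : D.Admissible) {P P' P'' : ℝ → Vec N}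
    (hP : ∀ t ∈ Icc 0 D.T, HasDerivWithinAt P (P' t) (Icc 0 D.T) t)
    (hP' : ∀ t ∈ Icc 0 D.T, HasDerivWithinAt P' (P'' t) (Icc 0 D.T) t)
    (hPeq : ∀ t ∈ Icc 0 D.T,
      act D.M (P'' t) - act D.C.transpose (P' t) + act D.K.transpose (P t) = 0)
    {u v : L2 p D.T} {X V Y W : ℝ → Vec N} (hu : D.IsState u X V) (hv : D.IsState v Y W) :
    inner ℝ (act D.C.transpose (P D.T) - act D.M (P' D.T)) (X D.T - Y D.T) +
      inner ℝ (act D.M (P D.T)) (V D.T - W D.T) =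
      ∫ t, inner ℝ (act D.B.transpose (P t)) (u t - v t) ∂leb D.T := by
  have hT := hD.T_pos.le
  have huI : uIcc 0 D.T = Icc 0 D.T := uIcc_of_le hT
  obtain ⟨hXc, hVc⟩ := hu.continuousOn hT
  obtain ⟨hYc, hWc⟩ := hv.continuousOn hT
  obtain ⟨A, hX, hV, hA⟩ := hu
  obtain ⟨A', hY, hW, hA'⟩ := hv
  have hii : ∀ a : L2 N D.T, IntervalIntegrable a volume 0 D.T := fun a => by
    rw [intervalIntegrable_iff_integrableOn_Ioo_of_le hT]
    exact L2.integrable a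
  have hci : ∀ {g : ℝ → ℝ}, ContinuousOn g (Icc 0 D.T) → IntervalIntegrable g volume 0 D.T :=
    fun hg => ContinuousOn.intervalIntegrable (huI ▸ hg)
  have hci' : ∀ {g : ℝ → Vec N}, ContinuousOn g (Icc 0 D.T) → IntervalIntegrable g volume 0 D.T :=
    fun hg => ContinuousOn.intervalIntegrable (huI ▸ hg)
  have hsub : ∀ {t}, t ∈ Icc 0 D.T → uIcc 0 t ⊆ uIcc 0 D.T := fun {t} ht => by
    rw [huI, uIcc_of_le ht.1]; exact Icc_subset_Icc_right ht.2
  have hPc : ContinuousOn P (Icc 0 D.T) := fun t ht => (hP t ht).continuousWithinAt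
  have hP'c : ContinuousOn P' (Icc 0 D.T) := fun t ht => (hP' t ht).continuousWithinAt
  have hx : ∀ t ∈ Icc 0 D.T, X t - Y t = ∫ s in (0 : ℝ)..t, (V s - W s) := fun t ht => by
    rw [hX t ht, hY t ht, intervalIntegral.integral_sub ((hci' hVc).mono_set (hsub ht))
      ((hci' hWc).mono_set (hsub ht))]
    abel
  have hy : ∀ t ∈ Icc 0 D.T, V t - W t = ∫ s in (0 : ℝ)..t, (A s - A' s) := fun t ht => by
    rw [hV t ht, hW t ht, intervalIntegral.integral_sub ((hii A).mono_set (hsub ht))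
      ((hii A').mono_set (hsub ht))]
    abel
  have hMP : ∀ t ∈ Icc 0 D.T,
      HasDerivWithinAt (fun t => act D.M (P t)) (act D.M (P' t)) (Icc 0 D.T) t := fun t ht =>
    (actL D.M).hasFDerivAt.comp_hasDerivWithinAt t (hP t ht)
  have hQ : ∀ t ∈ Icc 0 D.T, HasDerivWithinAt (fun t => act D.C.transpose (P t) - act D.M (P' t))
      (act D.K.transpose (P t)) (Icc 0 D.T) t := fun t ht => by
    have h := ((actL D.C.transpose).hasFDerivAt.comp_hasDerivWithinAt t (hP t ht)).sub
      ((actL D.M).hasFDerivAt.comp_hasDerivWithinAt t (hP' t ht))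
    convert! h using 1
    have := hPeq t ht
    simp only [actL_apply]
    rw [eq_neg_of_add_eq_zero_right this]
    abel
  have hMP'c : ContinuousOn (fun t => act D.M (P' t)) (Icc 0 D.T) :=
    (actL D.M).continuous.comp_continuousOn hP'c
  have hMPc : ContinuousOn (fun t => act D.M (P t)) (Icc 0 D.T) :=
    (actL D.M).continuous.comp_continuousOn hPc
  have hKPc : ContinuousOn (fun t => act D.K.transpose (P t)) (Icc 0 D.T) :=
    (actL D.K.transpose).continuous.comp_continuousOn hPc
  have hQc : ContinuousOn (fun t => act D.C.transpose (P t) - act D.M (P' t)) (Icc 0 D.T) :=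
    fun t ht => (hQ t ht).continuousWithinAt
  have h1 := integral_inner_primitive hT hMP hMP'c ((hii A).sub (hii A')) hy
  have h2 := integral_inner_primitive hT hQ hKPc ((hci' hVc).sub (hci' hWc)) hx
  have hae : ∫ t, inner ℝ (act D.B.transpose (P t)) (u t - v t) ∂leb D.T =
      ∫ t in (0 : ℝ)..D.T, (inner ℝ (act D.M (P t)) (A t - A' t) +
        inner ℝ (act D.C.transpose (P t)) (V t - W t) +
        inner ℝ (act D.K.transpose (P t)) (X t - Y t)) := by
    rw [← integral_leb_eq hT]
    refine integral_congr_ae ?_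
    filter_upwards [hA, hA'] with t h1 h2
    have h3 : act D.B (u t - v t) = act D.M (A t - A' t) + act D.C (V t - W t) +
        act D.K (X t - Y t) := by
      simp only [← actL_apply, map_sub] at h1 h2 ⊢
      have e1 : actL D.B (u t) = actL D.M (A t) + actL D.C (V t) + actL D.K (X t) - D.F t := by
        rw [h1]; abel
      have e2 : actL D.B (v t) = actL D.M (A' t) + actL D.C (W t) + actL D.K (Y t) - D.F t := by
        rw [h2]; abel
      rw [e1, e2]; abel
    rw [inner_act, Matrix.transpose_transpose, h3, inner_add_right, inner_add_right,
      inner_act D.M, transpose_eq hD.M_posDef, inner_act, inner_act, Matrix.transpose_transpose,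
      Matrix.transpose_transpose]
  have i1 : IntervalIntegrable (fun t => inner ℝ (act D.M (P t)) (A t - A' t)) volume 0 D.T := by
    have hb := ((hii A).sub (hii A'))
    rw [intervalIntegrable_iff_integrableOn_Icc_of_le hT] at hb ⊢
    obtain ⟨C, hC⟩ := isCompact_Icc.exists_bound_of_continuousOn hMPc
    refine Integrable.mono' (hb.norm.const_mul C)
      ((hMPc.aestronglyMeasurable measurableSet_Icc).inner hb.aestronglyMeasurable) ?_
    filter_upwards [ae_restrict_mem measurableSet_Icc] with t ht
    exact (norm_inner_le_norm _ _).trans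
      (mul_le_mul_of_nonneg_right (hC t ht) (norm_nonneg _))
  have i2 : IntervalIntegrable (fun t => inner ℝ (act D.C.transpose (P t)) (V t - W t))
      volume 0 D.T :=
    hci (((actL D.C.transpose).continuous.comp_continuousOn hPc).inner (hVc.sub hWc))
  have i3 : IntervalIntegrable (fun t => inner ℝ (act D.K.transpose (P t)) (X t - Y t))
      volume 0 D.T := hci (hKPc.inner (hXc.sub hYc))
  have i4 : IntervalIntegrable (fun t => inner ℝ (act D.M (P' t)) (V t - W t)) volume 0 D.T :=
    hci (hMP'c.inner (hVc.sub hWc))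
  simp only [inner_sub_left] at h2
  rw [intervalIntegral.integral_sub i2 i4] at h2
  rw [hae, intervalIntegral.integral_add (i1.add i2) i3, intervalIntegral.integral_add i1 i2, h1,
    inner_sub_left]
  linarith

end Data

theorem integral_add_add {Ω : Type*} [MeasurableSpace Ω] {μ : Measure Ω} {f g h : Ω → ℝ}
    (hf : Integrable f μ) (hg : Integrable g μ) (hh : Integrable h μ) :
    ∫ t, (f t + g t + h t) ∂μ = ∫ t, f t ∂μ + ∫ t, g t ∂μ + ∫ t, h t ∂μ  :=
  (integral_add (hf.add hg) hh).trans (congrArg (· + _) (integral_add hf hg))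

/-! ### The regularized norm, its integral and the multiplier. -/

section Penalty

variable {m : ℕ} {T : ℝ}

/-- The regularization `√(η + |x|²) - √η` of the norm. -/
def smoothNorm (η : ℝ) (x : Vec m) : ℝ := √(η + ‖x‖ ^ 2) - √η

/-- Seen as the norm of `(√η, x)`, the regularization inherits convexity and the Lipschitz constant
1 from the triangle inequality. The case `η = 0` is included, so `pen 0` treats the unregularized
penalty as well. -/
theorem sqrt_add_norm_sq {η : ℝ} (hη : 0 ≤ η) (x : Vec m) :
    √(η + ‖x‖ ^ 2) = ‖(WithLp.toLp 2 (√η, x) : WithLp 2 (ℝ × Vec m))‖ := by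
  rw [Real.sqrt_eq_iff_eq_sq (by positivity) (norm_nonneg _), WithLp.prod_norm_sq_eq_of_L2]
  simp [Real.sq_sqrt hη]

theorem smoothNorm_zero (x : Vec m) : smoothNorm 0 x = ‖x‖ := by
  simp [smoothNorm]

theorem smoothNorm_nonneg (η : ℝ) (x : Vec m) : 0 ≤ smoothNorm η x :=
  sub_nonneg.2 (Real.sqrt_le_sqrt (by nlinarith [sq_nonneg ‖x‖]))

theorem smoothNorm_le {η : ℝ} (hη : 0 ≤ η) (x : Vec m) : smoothNorm η x ≤ ‖x‖ := by
  have h := Real.sqrt_nonneg η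
  rw [smoothNorm, sub_le_iff_le_add]
  refine Real.sqrt_le_iff.2 ⟨by positivity, ?_⟩
  nlinarith [Real.sq_sqrt hη, norm_nonneg x, mul_nonneg h (norm_nonneg x)]

theorem norm_le_smoothNorm_add {η : ℝ} (hη : 0 ≤ η) (x : Vec m) : ‖x‖ ≤ smoothNorm η x + √η := by
  rw [smoothNorm, sub_add_cancel]
  exact Real.le_sqrt_of_sq_le (by linarith)

theorem smoothNorm_combo_le {η : ℝ} (hη : 0 ≤ η) {a b : ℝ} (ha : 0 ≤ a) (hb : 0 ≤ b)
    (hab : a + b = 1) (x y : Vec m) :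
    smoothNorm η (a • x + b • y) ≤ a * smoothNorm η x + b * smoothNorm η y := by
  have h : (WithLp.toLp 2 (√η, a • x + b • y) : WithLp 2 (ℝ × Vec m)) =
      a • WithLp.toLp 2 (√η, x) + b • WithLp.toLp 2 (√η, y) := by
    refine WithLp.ofLp_injective 2 (Prod.ext ?_ rfl)
    change √η = a * √η + b * √η
    rw [← add_mul, hab, one_mul]
  have h2 := norm_add_le (a • (WithLp.toLp 2 (√η, x) : WithLp 2 (ℝ × Vec m)))
    (b • WithLp.toLp 2 (√η, y))
  rw [← h, norm_smul, norm_smul, Real.norm_of_nonneg ha, Real.norm_of_nonneg hb,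
    ← sqrt_add_norm_sq hη, ← sqrt_add_norm_sq hη, ← sqrt_add_norm_sq hη] at h2
  simp only [smoothNorm]
  have : √η = (a + b) * √η := by rw [hab, one_mul]
  linarith

theorem abs_smoothNorm_sub_le {η : ℝ} (hη : 0 ≤ η) (x y : Vec m) :
    |smoothNorm η x - smoothNorm η y| ≤ ‖x - y‖ := by
  simp only [smoothNorm]
  rw [sub_sub_sub_cancel_right, sqrt_add_norm_sq hη, sqrt_add_norm_sq hη]
  refine (abs_norm_sub_norm_le _ _).trans ?_
  rw [← WithLp.toLp_sub, Prod.mk_sub_mk, sub_self]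
  refine le_of_sq_le_sq ?_ (norm_nonneg _)
  rw [WithLp.prod_norm_sq_eq_of_L2]
  simp

/-- With `r = √(η + |x|²)` this is `√(r² + d) ≤ r + d/(2r)`, and `r ≥ √η` makes the quadratic
coefficient independent of `x`. Such an upper bound yields the Euler equation without
differentiation under the integral. -/
theorem smoothNorm_add_smul_le {η : ℝ} (hη : 0 < η) (x y : Vec m) (s : ℝ) :
    smoothNorm η (x + s • y) ≤ smoothNorm η x + s * inner ℝ ((√(η + ‖x‖ ^ 2))⁻¹ • x) y +
      s ^ 2 * ((2 * √η)⁻¹ * ‖y‖ ^ 2) := by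
  set r := √(η + ‖x‖ ^ 2) with hr
  have hηs : 0 < √η := Real.sqrt_pos.2 hη
  have hηr : √η ≤ r := Real.sqrt_le_sqrt (by nlinarith [sq_nonneg ‖x‖])
  have hrp : 0 < r := hηs.trans_le hηr
  have hr2 : r ^ 2 = η + ‖x‖ ^ 2 := Real.sq_sqrt (by positivity)
  have hexp : ‖x + s • y‖ ^ 2 = ‖x‖ ^ 2 + 2 * s * inner ℝ x y + s ^ 2 * ‖y‖ ^ 2 := by
    rw [norm_add_sq_real, inner_smul_right, norm_smul, mul_pow, Real.norm_eq_abs, sq_abs]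
    ring
  set d := 2 * s * inner ℝ x y + s ^ 2 * ‖y‖ ^ 2 with hd
  have hd0 : 0 ≤ r ^ 2 + d := by
    have : r ^ 2 + d = η + ‖x + s • y‖ ^ 2 := by rw [hexp, hr2]; ring
    rw [this]; positivity
  have h1 : √(η + ‖x + s • y‖ ^ 2) ≤ r + d / (2 * r) := by
    have e : η + ‖x + s • y‖ ^ 2 = r ^ 2 + d := by rw [hexp, hr2]; ring
    rw [e]
    refine Real.sqrt_le_iff.2 ⟨?_, ?_⟩
    · have : r + d / (2 * r) = (r ^ 2 + (r ^ 2 + d)) / (2 * r) := by field_simp; ring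
      rw [this]; positivity
    · have : (r + d / (2 * r)) ^ 2 = r ^ 2 + d + (d / (2 * r)) ^ 2 := by field_simp; ring
      rw [this]; nlinarith [sq_nonneg (d / (2 * r))]
  have h2 : d / (2 * r) = s * (r⁻¹ * inner ℝ x y) + s ^ 2 * ((2 * r)⁻¹ * ‖y‖ ^ 2) := by
    rw [hd]; field_simp
  have h3 : s ^ 2 * ((2 * r)⁻¹ * ‖y‖ ^ 2) ≤ s ^ 2 * ((2 * √η)⁻¹ * ‖y‖ ^ 2) := by gcongr
  rw [real_inner_smul_left]
  simp only [smoothNorm]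
  linarith

theorem continuous_smoothNorm (η : ℝ) : Continuous (smoothNorm η : Vec m → ℝ) := by
  unfold smoothNorm
  fun_prop

theorem integrable_smoothNorm {η : ℝ} (hη : 0 ≤ η) (f : L2 m T) :
    Integrable (fun t => smoothNorm η (f t)) (leb T) := by
  refine (L2.integrable f).norm.mono'
    ((continuous_smoothNorm η).comp_aestronglyMeasurable (Lp.aestronglyMeasurable f))
    (Eventually.of_forall fun t => ?_)
  rw [Real.norm_of_nonneg (smoothNorm_nonneg _ _)]
  exact smoothNorm_le hη _

/-- The functional `f ↦ ∫ (√(η + |f|²) - √η)`. -/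
def pen (η : ℝ) (f : L2 m T) : ℝ := ∫ t, smoothNorm η (f t) ∂leb T

theorem pen_nonneg (η : ℝ) (f : L2 m T) : 0 ≤ pen η f :=
  integral_nonneg fun _ => smoothNorm_nonneg _ _

theorem pen_le {η : ℝ} (hη : 0 ≤ η) (f : L2 m T) : pen η f ≤ pen 0 f := by
  refine integral_mono (integrable_smoothNorm hη f) (integrable_smoothNorm le_rfl f) fun t => ?_
  rw [smoothNorm_zero]
  exact smoothNorm_le hη _

theorem pen_zero_le (hT : 0 ≤ T) {η : ℝ} (hη : 0 ≤ η) (f : L2 m T) :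
    pen 0 f ≤ pen η f + T * √η := by
  have h : ∫ t, (smoothNorm η (f t) + √η) ∂leb T = pen η f + T * √η := by
    rw [integral_add (integrable_smoothNorm hη f) (integrable_const _), integral_const]
    simp [pen, leb, hT]
  rw [← h]
  refine integral_mono (integrable_smoothNorm le_rfl f)
    ((integrable_smoothNorm hη f).add (integrable_const _)) fun t => ?_
  rw [smoothNorm_zero]
  exact norm_le_smoothNorm_add hη _

theorem pen_combo_le {η : ℝ} (hη : 0 ≤ η) {a b : ℝ} (ha : 0 ≤ a) (hb : 0 ≤ b)
    (hab : a + b = 1) (f g : L2 m T) : pen η (a • f + b • g) ≤ a * pen η f + b * pen η g := by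
  have i1 := (integrable_smoothNorm hη f).const_mul a
  have i2 := (integrable_smoothNorm hη g).const_mul b
  rw [pen, pen, pen, ← integral_const_mul, ← integral_const_mul, ← integral_add i1 i2]
  refine integral_mono_ae (integrable_smoothNorm hη _) (i1.add i2) ?_
  filter_upwards [Lp.coeFn_add (a • f) (b • g), Lp.coeFn_smul a f, Lp.coeFn_smul b g] with t h1 h2 h3
  rw [h1, Pi.add_apply, h2, h3]
  exact smoothNorm_combo_le hη ha hb hab _ _

theorem continuous_pen (hT : 0 ≤ T) {η : ℝ} (hη : 0 ≤ η) :
    Continuous (pen η : L2 m T → ℝ) := by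
  refine LipschitzWith.continuous (K := (√T).toNNReal) (LipschitzWith.of_dist_le_mul fun f g => ?_)
  rw [Real.coe_toNNReal _ (Real.sqrt_nonneg _), Real.dist_eq, dist_eq_norm, pen, pen,
    ← integral_sub (integrable_smoothNorm hη f) (integrable_smoothNorm hη g)]
  refine le_trans ?_ (integral_norm_le hT (f - g))
  refine (abs_integral_le_integral_abs).trans ?_
  refine integral_mono_ae
    ((integrable_smoothNorm hη f).sub (integrable_smoothNorm hη g)).abs (L2.integrable _).norm ?_
  filter_upwards [Lp.coeFn_sub f g] with t h
  rw [h]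
  exact abs_smoothNorm_sub_le hη _ _

theorem norm_multiplier_le {η : ℝ} (hη : 0 ≤ η) (w : H10 m T) (t : ℝ) :
    ‖multiplier η w t‖ ≤ 1 := by
  rw [multiplier, norm_smul, norm_inv, Real.norm_of_nonneg (Real.sqrt_nonneg _)]
  refine inv_mul_le_one_of_le₀ (Real.le_sqrt_of_sq_le (by linarith)) (Real.sqrt_nonneg _)

theorem aestronglyMeasurable_multiplier (η : ℝ) (w : H10 m T) :
    AEStronglyMeasurable (multiplier η w) (leb T) := by
  have h := (Lp.aestronglyMeasurable w.der)
  have h1 : AEMeasurable (fun t => (√(η + ‖w.der t‖ ^ 2))⁻¹) (leb T) :=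
    ((h.norm.aemeasurable.pow_const 2).const_add η).sqrt.inv
  exact h1.aestronglyMeasurable.smul h

theorem memLp_multiplier {η : ℝ} (hη : 0 ≤ η) (w : H10 m T) (q : ENNReal) :
    MemLp (multiplier η w) q (leb T) :=
  MemLp.of_bound (aestronglyMeasurable_multiplier η w) 1
    (Eventually.of_forall (norm_multiplier_le hη w))

open Classical in
/-- The multiplier `w' / √(η + |w'|²)` as an element of `L²`. -/
def multL2 (η : ℝ) (w : H10 m T) : L2 m T :=
  -- For negative `η` the multiplier need not be bounded; the value 0 plays no role in limits along
  -- `𝓝[>] 0`.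
  if hη : 0 ≤ η then (memLp_multiplier hη w 2).toLp _ else 0

theorem coeFn_multL2 {η : ℝ} (hη : 0 ≤ η) (w : H10 m T) :
    (multL2 η w : ℝ → Vec m) =ᵐ[leb T] multiplier η w := by
  rw [multL2, dif_pos hη]
  exact MemLp.coeFn_toLp _

theorem pen_add_smul_le {η : ℝ} (hη : 0 < η) (w : H10 m T) (g : L2 m T) (s : ℝ) :
    pen η (derL m T w + s • g) ≤ pen η (derL m T w) + s * inner ℝ (multL2 η w) g +
      s ^ 2 * ((2 * √η)⁻¹ * ‖g‖ ^ 2) := by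
  have i1 := integrable_smoothNorm hη.le (derL m T w)
  have i2 := (L2.integrable_inner (𝕜 := ℝ) (multL2 η w) g).const_mul s
  have i3 := ((L2.integrable_norm_sq g).const_mul (2 * √η)⁻¹).const_mul (s ^ 2)
  rw [MeasureTheory.L2.inner_def, L2.norm_sq_eq, ← integral_const_mul, ← integral_const_mul,
    ← integral_const_mul, pen, pen, ← integral_add_add i1 i2 i3]
  refine integral_mono_ae (integrable_smoothNorm hη.le _) ((i1.add i2).add i3) ?_
  filter_upwards [Lp.coeFn_add (derL m T w) (s • g), Lp.coeFn_smul s g, coeFn_multL2 hη.le w]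
    with t h1 h2 h3
  rw [h1, Pi.add_apply, h2, Pi.smul_apply, h3]
  exact smoothNorm_add_smul_le hη _ _ s

end Penalty

/-! ### Strong convexity and the regularized problem. -/

theorem norm_sq_combo {E : Type*} [NormedAddCommGroup E] [InnerProductSpace ℝ E] {a b : ℝ}
    (hab : a + b = 1) (x y : E) :
    ‖a • x + b • y‖ ^ 2 = a * ‖x‖ ^ 2 + b * ‖y‖ ^ 2 - a * b * ‖x - y‖ ^ 2 := by
  have hb : b = 1 - a := by linarith
  subst hb
  rw [norm_add_sq_real, norm_sub_sq_real, norm_smul, norm_smul, inner_smul_left, inner_smul_right,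
    mul_pow, mul_pow, Real.norm_eq_abs, Real.norm_eq_abs, sq_abs, sq_abs]
  simp only [conj_trivial]
  ring

theorem nonneg_of_forall_add_mul_nonneg {A B : ℝ} (h : ∀ s, 0 < s → s < 1 → 0 ≤ A + s * B) :
    0 ≤ A := by
  by_contra hA
  push Not at hA
  have hd : 0 < -A + |B| + 1 := by linarith [abs_nonneg B]
  -- This `s` lies in `]0,1[` and satisfies `s|B| < -A`.
  have h1 := h (-A / (-A + |B| + 1)) (by apply div_pos <;> linarith)
    (by rw [div_lt_one hd]; linarith [abs_nonneg B])
  have h2 : -A / (-A + |B| + 1) * B ≤ -A / (-A + |B| + 1) * |B| :=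
    mul_le_mul_of_nonneg_left (le_abs_self B) (div_nonneg (by linarith) hd.le)
  have h3 : -A / (-A + |B| + 1) * |B| < -A := by
    rw [div_mul_eq_mul_div, div_lt_iff₀ hd]
    nlinarith
  linarith

/-- Fermat's rule when only a quadratic upper bound of the increment is known: divide by `s` of
either sign and let it tend to 0. -/
theorem eq_zero_of_forall_quadratic_nonneg {L C : ℝ} (h : ∀ s : ℝ, 0 ≤ s * L + s ^ 2 * C) :
    L = 0 := by
  refine le_antisymm ?_ ?_
  · have : 0 ≤ -L := nonneg_of_forall_add_mul_nonneg (B := C) fun s hs _ => by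
      have := h (-s)
      have h2 : 0 ≤ s * (-L + s * C) := by nlinarith
      exact nonneg_of_mul_nonneg_right h2 hs
    linarith
  · exact nonneg_of_forall_add_mul_nonneg (B := C) fun s hs _ => by
      have := h s
      have h2 : 0 ≤ s * (L + s * C) := by nlinarith
      exact nonneg_of_mul_nonneg_right h2 hs

namespace Data

variable {N p : ℕ} (D : Data N p)

/-- The cost of a control: `ε/2 ∫ [α|v|² + β|v'|² + 2γ(√(η + |v'|²) - √η)]`. -/
def energy (η : ℝ) (v : H10 p D.T) : ℝ :=
  D.ε / 2 * (D.α * ‖fnL p D.T v‖ ^ 2 + D.β * ‖derL p D.T v‖ ^ 2 + 2 * D.γ * pen η (derL p D.T v))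

theorem integral_energy {η : ℝ} (hη : 0 ≤ η) (v : H10 p D.T) :
    ∫ t, (D.α * ‖v.fn t‖ ^ 2 + D.β * ‖v.der t‖ ^ 2 + 2 * D.γ * smoothNorm η (v.der t)) ∂leb D.T =
      D.α * ‖fnL p D.T v‖ ^ 2 + D.β * ‖derL p D.T v‖ ^ 2 + 2 * D.γ * pen η (derL p D.T v) := by
  have i1 := (L2.integrable_norm_sq v.fn).const_mul D.α
  have i2 := (L2.integrable_norm_sq v.der).const_mul D.β
  have i3 := (integrable_smoothNorm hη v.der).const_mul (2 * D.γ)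
  rw [integral_add_add i1 i2 i3, integral_const_mul, integral_const_mul,
    integral_const_mul, ← L2.norm_sq_eq, ← L2.norm_sq_eq]
  rfl

theorem cost_eq (v : H10 p D.T) (X V : ℝ → Vec N) :
    D.cost v X V = 1 / 2 * (‖X D.T‖ ^ 2 + ‖V D.T‖ ^ 2) + D.energy 0 v := by
  have h := D.integral_energy le_rfl v
  simp only [smoothNorm_zero] at h
  rw [cost, h, energy]
  ring

theorem regCost_eq {P : ℝ → Vec N} {b : L2 p D.T}
    (hb : (b : ℝ → Vec p) =ᵐ[leb D.T] fun t => act D.B.transpose (P t)) {η : ℝ} (hη : 0 ≤ η)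
    (v : H10 p D.T) : D.regCost P η v = D.energy η v + inner ℝ b (fnL p D.T v) := by
  rw [regCost, energy, ← D.integral_energy hη v, MeasureTheory.L2.inner_def]
  refine congrArg (D.ε / 2 * _ + ·) (integral_congr_ae ?_)
  filter_upwards [hb] with t ht
  rw [ht]
  rfl

variable {D}

/-- The modulus comes from the `β` term alone. General weights are kept because `quadratic_growth`
lets one of them tend to 0. -/
theorem energy_combo_le (hD : D.Admissible) {η : ℝ} (hη : 0 ≤ η) {a b : ℝ} (ha : 0 ≤ a)
    (hb : 0 ≤ b) (hab : a + b = 1) (u v : H10 p D.T) :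
    D.energy η (a • u + b • v) ≤ a * D.energy η u + b * D.energy η v -
      a * b * (D.ε * D.β / 2 * ‖derL p D.T (u - v)‖ ^ 2) := by
  have h := pen_combo_le hη ha hb hab (derL p D.T u) (derL p D.T v)
  have h1 : 0 ≤ D.α * (a * b * ‖fnL p D.T u - fnL p D.T v‖ ^ 2) :=
    mul_nonneg hD.α_nonneg (by positivity)
  have h2 := mul_le_mul_of_nonneg_left h (mul_nonneg (zero_le_two (α := ℝ)) hD.γ_pos.le)
  have h3 := hD.ε_pos
  simp only [energy, map_add, map_smul, map_sub]
  rw [norm_sq_combo hab, norm_sq_combo hab]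
  have h4 := mul_le_mul_of_nonneg_left h2 (half_pos h3).le
  have h5 := mul_nonneg (half_pos h3).le h1
  linarith

theorem continuous_energy (hD : D.Admissible) {η : ℝ} (hη : 0 ≤ η) : Continuous (D.energy η) := by
  have h1 := (fnL p D.T).continuous
  have h2 := (derL p D.T).continuous
  have h3 := (continuous_pen (m := p) hD.T_pos.le hη).comp h2
  exact continuous_const.mul (((continuous_const.mul (h1.norm.pow 2)).add
    (continuous_const.mul (h2.norm.pow 2))).add (continuous_const.mul h3))

theorem le_energy (hD : D.Admissible) (η : ℝ) (v : H10 p D.T) :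
    D.ε * D.β / 2 * ‖derL p D.T v‖ ^ 2 ≤ D.energy η v := by
  have h1 := mul_nonneg hD.α_nonneg (sq_nonneg ‖fnL p D.T v‖)
  have h2 := mul_nonneg hD.γ_pos.le (pen_nonneg η (derL p D.T v))
  have h3 := mul_nonneg (half_pos hD.ε_pos).le h1
  have h4 := mul_nonneg hD.ε_pos.le h2
  rw [energy]
  linarith

/-- `εβ/8` is the modulus `εβ/2` times the weights `1/2 · 1/2` of a midpoint; `T² + 1` comes from
Poincaré. -/
theorem norm_sq_le_der (hD : D.Admissible) (v : H10 p D.T) :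
    D.ε * D.β / (8 * (D.T ^ 2 + 1)) * ‖v‖ ^ 2 ≤ D.ε * D.β / 8 * ‖derL p D.T v‖ ^ 2 := by
  have h := norm_le_der hD.T_pos.le v
  have h2 := hD.ε_pos
  have h3 := hD.β_pos
  have h4 : 0 < D.ε * D.β / (8 * (D.T ^ 2 + 1)) := by positivity
  calc _ ≤ D.ε * D.β / (8 * (D.T ^ 2 + 1)) * ((D.T ^ 2 + 1) * ‖derL p D.T v‖ ^ 2) :=
        mul_le_mul_of_nonneg_left h h4.le
    _ = _ := by field_simp

theorem energy_midpoint_le (hD : D.Admissible) {η : ℝ} (hη : 0 ≤ η) (u v : H10 p D.T) :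
    D.energy η ((1 / 2 : ℝ) • (u + v)) ≤ 1 / 2 * D.energy η u + 1 / 2 * D.energy η v -
      D.ε * D.β / (8 * (D.T ^ 2 + 1)) * ‖u - v‖ ^ 2 := by
  have h := energy_combo_le hD hη (a := 1 / 2) (b := 1 / 2) (by norm_num) (by norm_num)
    (by norm_num) u v
  have h2 := norm_sq_le_der hD (u - v)
  rw [smul_add]
  linarith

theorem existsUnique_regMinimizer (hD : D.Admissible) {P : ℝ → Vec N} {b : L2 p D.T}
    (hb : (b : ℝ → Vec p) =ᵐ[leb D.T] fun t => act D.B.transpose (P t)) {η : ℝ} (hη : 0 ≤ η) :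
    ∃! w : H10 p D.T, D.IsRegMinimizer P η w := by
  have hT := hD.T_pos
  have hε := hD.ε_pos
  have hβ := hD.β_pos
  simp only [IsRegMinimizer, D.regCost_eq hb hη]
  -- With `x = ‖v'‖` and `c = εβ`, the functional is at least `(c/2)x² - ‖b‖Tx`; `m` is the minimum
  -- of this quadratic, found by completing the square.
  refine existsUnique_minimizer (κ := D.ε * D.β / (8 * (D.T ^ 2 + 1)))
    (m := -((‖b‖ * D.T) ^ 2 / (2 * (D.ε * D.β)))) ?_ (fun v => ?_) (by positivity) fun u v => ?_
  · exact (continuous_energy hD hη).add (continuous_const.inner (fnL p D.T).continuous)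
  · have h1 := le_energy hD η v
    have h2 := (abs_le.1 (abs_real_inner_le_norm b (fnL p D.T v))).1
    have h3 := mul_le_mul_of_nonneg_left (poincare hT.le v) (norm_nonneg b)
    set x := ‖derL p D.T v‖
    set c := D.ε * D.β with hc
    have hc0 : 0 < c := mul_pos hε hβ
    have h4 : 0 ≤ (c * x - ‖b‖ * D.T) ^ 2 / (2 * c) := by positivity
    have h5 : (c * x - ‖b‖ * D.T) ^ 2 / (2 * c) =
        c / 2 * x ^ 2 - ‖b‖ * (D.T * x) + (‖b‖ * D.T) ^ 2 / (2 * c) := by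
      field_simp; ring
    linarith
  · have h := energy_midpoint_le hD hη u v
    have e : inner ℝ b (fnL p D.T ((1 / 2 : ℝ) • (u + v))) =
        1 / 2 * inner ℝ b (fnL p D.T u) + 1 / 2 * inner ℝ b (fnL p D.T v) := by
      rw [map_smul, map_add, inner_smul_right, inner_add_right]; ring
    rw [e]
    linarith

/-- The Euler equation of the regularized problem. -/
theorem IsRegMinimizer.euler (hD : D.Admissible) {P : ℝ → Vec N} {b : L2 p D.T}
    (hb : (b : ℝ → Vec p) =ᵐ[leb D.T] fun t => act D.B.transpose (P t)) {η : ℝ} (hη : 0 < η)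
    {w : H10 p D.T} (hw : D.IsRegMinimizer P η w) (v : H10 p D.T) :
    D.ε * (D.α * inner ℝ (fnL p D.T w) (fnL p D.T v) + D.β * inner ℝ (derL p D.T w) (derL p D.T v) +
      D.γ * inner ℝ (multL2 η w) (derL p D.T v)) + inner ℝ b (fnL p D.T v) = 0 := by
  -- `C` collects the second-order terms; its blow-up as `η → 0` is harmless since `η` is fixed.
  refine eq_zero_of_forall_quadratic_nonneg (C := D.ε / 2 * (D.α * ‖fnL p D.T v‖ ^ 2 +
    D.β * ‖derL p D.T v‖ ^ 2 + 2 * D.γ * ((2 * √η)⁻¹ * ‖derL p D.T v‖ ^ 2))) fun s => ?_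
  have h := hw (w + s • v)
  rw [D.regCost_eq hb hη.le, D.regCost_eq hb hη.le, energy, energy] at h
  have hp := pen_add_smul_le hη w (derL p D.T v) s
  have hp2 := mul_le_mul_of_nonneg_left hp (mul_nonneg hD.ε_pos.le hD.γ_pos.le)
  simp only [map_add, map_smul] at h
  rw [norm_add_sq_real, norm_add_sq_real, norm_smul, norm_smul, inner_smul_right, inner_smul_right,
    mul_pow, mul_pow, Real.norm_eq_abs, sq_abs, inner_add_right, inner_smul_right] at h
  linarith

end Data

/-! ### The optimal control and convergence of the regularized minimizers. -/

namespace Data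

variable {N p : ℕ} {D : Data N p}

theorem exists_L2_of_continuousOn {P : ℝ → Vec N} (hP : ContinuousOn P (Icc 0 D.T)) :
    ∃ b : L2 p D.T, (b : ℝ → Vec p) =ᵐ[leb D.T] fun t => act D.B.transpose (P t) := by
  have hc : ContinuousOn (fun t => act D.B.transpose (P t)) (Icc 0 D.T) :=
    (actL D.B.transpose).continuous.comp_continuousOn hP
  obtain ⟨C, hC⟩ := isCompact_Icc.exists_bound_of_continuousOn hc
  have hm : MemLp (fun t => act D.B.transpose (P t)) 2 (leb D.T) := by
    refine MemLp.of_bound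
      ((hc.mono Ioo_subset_Icc_self).aestronglyMeasurable measurableSet_Ioo) C ?_
    filter_upwards [ae_restrict_mem measurableSet_Ioo] with t ht
    exact hC t (Ioo_subset_Icc_self ht)
  exact ⟨hm.toLp _, hm.coeFn_toLp⟩

/-- The adjoint state represents the derivative of the final state with respect to the control. -/
theorem adjoint_pairing_inner (hD : D.Admissible) {P P' P'' : ℝ → Vec N}
    (hP : ∀ t ∈ Icc 0 D.T, HasDerivWithinAt P (P' t) (Icc 0 D.T) t)
    (hP' : ∀ t ∈ Icc 0 D.T, HasDerivWithinAt P' (P'' t) (Icc 0 D.T) t)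
    (hPeq : ∀ t ∈ Icc 0 D.T,
      act D.M (P'' t) - act D.C.transpose (P' t) + act D.K.transpose (P t) = 0)
    {x y : Vec N} (hy : act D.M (P D.T) = y)
    (hx : act D.M (P' D.T) = -x + act D.C.transpose (P D.T))
    {b : L2 p D.T} (hb : (b : ℝ → Vec p) =ᵐ[leb D.T] fun t => act D.B.transpose (P t))
    {u v : L2 p D.T} {X V Y W : ℝ → Vec N} (hu : D.IsState u X V) (hv : D.IsState v Y W) :
    inner ℝ x (X D.T - Y D.T) + inner ℝ y (V D.T - W D.T) = inner ℝ b (u - v) := by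
  have h := adjoint_pairing D hD hP hP' hPeq hu hv
  have hx' : act D.C.transpose (P D.T) - act D.M (P' D.T) = x := by rw [hx]; abel
  rw [hx', hy] at h
  rw [h, MeasureTheory.L2.inner_def]
  refine integral_congr_ae ?_
  filter_upwards [hb, Lp.coeFn_sub u v] with t h1 h2
  rw [h1, h2, Pi.sub_apply]

theorem exists_representative (hD : D.Admissible) (x y : Vec N) : ∃ b : L2 p D.T,
    ∀ (u v : L2 p D.T) (X V Y W : ℝ → Vec N), D.IsState u X V → D.IsState v Y W →
      inner ℝ x (X D.T - Y D.T) + inner ℝ y (V D.T - W D.T) = inner ℝ b (u - v) := by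
  obtain ⟨P, P', P'', hP, hP', hPeq, hy, hx⟩ := D.exists_adjoint hD x y
  obtain ⟨b, hb⟩ := exists_L2_of_continuousOn (D := D)
    (fun t ht => (hP t ht).continuousWithinAt : ContinuousOn P (Icc 0 D.T))
  exact ⟨b, fun u v X V Y W hu hv =>
    adjoint_pairing_inner hD hP hP' hPeq hy hx hb hu hv⟩

/-- Uniqueness, continuity and affinity of the final state are all read off the adjoint
representation: each scalar component of a difference of final states is an `L²` inner product with
the difference of the controls. -/
theorem exists_endpoint_maps (hD : D.Admissible) : ∃ ξ ζ : L2 p D.T → Vec N,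
    (∀ u X V, D.IsState u X V → X D.T = ξ u ∧ V D.T = ζ u) ∧ Continuous ξ ∧ Continuous ζ ∧
    ∀ (a b : ℝ) (u v : L2 p D.T), a + b = 1 →
      ξ (a • u + b • v) = a • ξ u + b • ξ v ∧ ζ (a • u + b • v) = a • ζ u + b • ζ v := by
  choose X V hXV using D.exists_isState hD
  choose r hr using exists_representative hD
  have hunique : ∀ u Y W, D.IsState u Y W → Y D.T = X u D.T ∧ W D.T = V u D.T := by
    intro u Y W h
    constructor
    · refine sub_eq_zero.1 (ext_inner_left ℝ fun x => ?_)
      simpa using hr x 0 u u Y W (X u) (V u) h (hXV u)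
    · refine sub_eq_zero.1 (ext_inner_left ℝ fun y => ?_)
      simpa using hr 0 y u u Y W (X u) (V u) h (hXV u)
  have hξ : ∀ x u v, inner ℝ x (X u D.T - X v D.T) = inner ℝ (r x 0) (u - v) := fun x u v => by
    simpa using hr x 0 u v _ _ _ _ (hXV u) (hXV v)
  have hζ : ∀ y u v, inner ℝ y (V u D.T - V v D.T) = inner ℝ (r 0 y) (u - v) := fun y u v => by
    simpa using hr 0 y u v _ _ _ _ (hXV u) (hXV v)
  have hcont : ∀ (f : L2 p D.T → Vec N) (s : Vec N → L2 p D.T),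
      (∀ x u v, inner ℝ x (f u - f v) = inner ℝ (s x) (u - v)) → Continuous f := by
    intro f s hs
    refine (PiLp.continuous_toLp 2 _).comp (f := fun u => (f u).ofLp) (continuous_pi fun i => ?_)
    have : (fun u => (f u).ofLp i) = fun u =>
        inner ℝ (s (EuclideanSpace.single i 1)) (u - 0) + f 0 i := by
      ext u
      rw [← hs]
      simp [EuclideanSpace.inner_single_left]
    rw [this]
    fun_prop
  have haff : ∀ (f : L2 p D.T → Vec N) (s : Vec N → L2 p D.T),
      (∀ x u v, inner ℝ x (f u - f v) = inner ℝ (s x) (u - v)) → ∀ (a b : ℝ) (u v : L2 p D.T),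
      a + b = 1 → f (a • u + b • v) = a • f u + b • f v := by
    intro f s hs a b u v hab
    have e1 : a • f u + b • f v = f v + a • (f u - f v) := by
      rw [show b = 1 - a by linarith]; module
    have e2 : a • u + b • v - v = a • (u - v) := by
      rw [show b = 1 - a by linarith]; module
    rw [e1, ← sub_eq_iff_eq_add']
    refine ext_inner_left ℝ fun x => ?_
    rw [hs, e2, inner_smul_right, inner_smul_right, hs]
  exact ⟨fun u => X u D.T, fun u => V u D.T, hunique, hcont _ _ hξ, hcont _ _ hζ,
    fun a b u v hab => ⟨haff _ _ hξ a b u v hab, haff _ _ hζ a b u v hab⟩⟩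

theorem isOptimalControl_iff (hD : D.Admissible) {ξ ζ : L2 p D.T → Vec N}
    (h : ∀ u X V, D.IsState u X V → X D.T = ξ u ∧ V D.T = ζ u) (u : H10 p D.T) :
    D.IsOptimalControl u ↔ ∀ v : H10 p D.T,
      1 / 2 * (‖ξ (fnL p D.T u)‖ ^ 2 + ‖ζ (fnL p D.T u)‖ ^ 2) + D.energy 0 u ≤
      1 / 2 * (‖ξ (fnL p D.T v)‖ ^ 2 + ‖ζ (fnL p D.T v)‖ ^ 2) + D.energy 0 v := by
  constructor
  · rintro ⟨X, V, hX, hmin⟩ v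
    obtain ⟨Y, W, hY⟩ := D.exists_isState hD v.fn
    have := hmin v Y W hY
    rwa [cost_eq, cost_eq, (h _ _ _ hX).1, (h _ _ _ hX).2, (h _ _ _ hY).1, (h _ _ _ hY).2] at this
  · intro hu
    obtain ⟨X, V, hX⟩ := D.exists_isState hD u.fn
    refine ⟨X, V, hX, fun v Y W hY => ?_⟩
    rw [cost_eq, cost_eq, (h _ _ _ hX).1, (h _ _ _ hX).2, (h _ _ _ hY).1, (h _ _ _ hY).2]
    exact hu v

theorem existsUnique_isOptimalControl (hD : D.Admissible) :
    ∃! u : H10 p D.T, D.IsOptimalControl u := by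
  have hT := hD.T_pos
  have hε := hD.ε_pos
  have hβ := hD.β_pos
  obtain ⟨ξ, ζ, hst, hξ, hζ, haff⟩ := exists_endpoint_maps hD
  simp only [isOptimalControl_iff hD hst]
  refine existsUnique_minimizer (κ := D.ε * D.β / (8 * (D.T ^ 2 + 1))) (m := 0) ?_ (fun v => ?_)
    (by positivity) fun u v => ?_
  · have h1 := hξ.comp (fnL p D.T).continuous
    have h2 := hζ.comp (fnL p D.T).continuous
    exact (continuous_const.mul ((h1.norm.pow 2).add (h2.norm.pow 2))).add
      (continuous_energy hD le_rfl)
  · have h1 := le_energy hD 0 v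
    have h2 : 0 ≤ D.ε * D.β / 2 * ‖derL p D.T v‖ ^ 2 := by positivity
    have h3 : 0 ≤ 1 / 2 * (‖ξ (fnL p D.T v)‖ ^ 2 + ‖ζ (fnL p D.T v)‖ ^ 2) := by positivity
    linarith
  · have h := energy_midpoint_le hD le_rfl u v
    obtain ⟨h1, h2⟩ := haff (1 / 2) (1 / 2) (fnL p D.T u) (fnL p D.T v) (by norm_num)
    have e : fnL p D.T ((1 / 2 : ℝ) • (u + v)) =
        (1 / 2 : ℝ) • fnL p D.T u + (1 / 2 : ℝ) • fnL p D.T v := by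
      rw [map_smul, map_add, smul_add]
    rw [e, h1, h2, norm_sq_combo (by norm_num), norm_sq_combo (by norm_num)]
    have h3 := sq_nonneg ‖ξ (fnL p D.T u) - ξ (fnL p D.T v)‖
    have h4 := sq_nonneg ‖ζ (fnL p D.T u) - ζ (fnL p D.T v)‖
    linarith

theorem exists_isAdjointState (hD : D.Admissible) (u : H10 p D.T) :
    ∃ P, D.IsAdjointState u P := by
  obtain ⟨X, V, hX⟩ := D.exists_isState hD u.fn
  obtain ⟨P, P', P'', h⟩ := D.exists_adjoint hD (X D.T) (V D.T)
  exact ⟨P, X, V, P', P'', hX, h⟩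

theorem IsAdjointState.exists_L2 {u : H10 p D.T} {P : ℝ → Vec N} (h : D.IsAdjointState u P) :
    ∃ b : L2 p D.T, (b : ℝ → Vec p) =ᵐ[leb D.T] fun t => act D.B.transpose (P t) := by
  obtain ⟨_, _, _, _, _, hP, _⟩ := h
  exact exists_L2_of_continuousOn fun t ht => (hP t ht).continuousWithinAt

/-- The optimal control minimizes the linearized criterion, with quadratic growth. -/
theorem IsOptimalControl.quadratic_growth (hD : D.Admissible) {u : H10 p D.T}
    (hu : D.IsOptimalControl u) {P : ℝ → Vec N} (hP : D.IsAdjointState u P) {b : L2 p D.T}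
    (hb : (b : ℝ → Vec p) =ᵐ[leb D.T] fun t => act D.B.transpose (P t)) (v : H10 p D.T) :
    D.energy 0 u + inner ℝ b (fnL p D.T u) + D.ε * D.β / 2 * ‖derL p D.T (u - v)‖ ^ 2 ≤
      D.energy 0 v + inner ℝ b (fnL p D.T v) := by
  obtain ⟨ξ, ζ, hst, -, -, haff⟩ := exists_endpoint_maps hD
  rw [isOptimalControl_iff hD hst] at hu
  obtain ⟨X, V, P', P'', hX, hP1, hP2, hPeq, hPT, hPT'⟩ := hP
  obtain ⟨Y, W, hY⟩ := D.exists_isState hD v.fn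
  have hpair := adjoint_pairing_inner hD hP1 hP2 hPeq hPT hPT' hb hY hX
  rw [(hst _ _ _ hX).1, (hst _ _ _ hX).2, (hst _ _ _ hY).1, (hst _ _ _ hY).2, H10.fn_eq,
    H10.fn_eq] at hpair
  set x := ξ (fnL p D.T u)
  set y := ζ (fnL p D.T u)
  set x' := ξ (fnL p D.T v)
  set y' := ζ (fnL p D.T v)
  rw [inner_sub_right (𝕜 := ℝ) b] at hpair
  set κ := D.ε * D.β / 2 * ‖derL p D.T (u - v)‖ ^ 2
  suffices h : 0 ≤ D.energy 0 v - D.energy 0 u +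
      (inner ℝ b (fnL p D.T v) - inner ℝ b (fnL p D.T u)) - κ by linarith
  -- Compare `u` with `(1 - s)u + sv` and divide by `s`. `B` gathers what is of order `s²` before
  -- the division: the squared final displacements, and the `κ` from `-(1 - s)sκ`.
  refine nonneg_of_forall_add_mul_nonneg
    (B := 1 / 2 * (‖x' - x‖ ^ 2 + ‖y' - y‖ ^ 2) + κ) fun s hs hs1 => ?_
  have h1 := hu ((1 - s) • u + s • v)
  have h2 := energy_combo_le hD (le_refl (0 : ℝ)) (a := 1 - s) (b := s) (by linarith) hs.le
    (by ring) u v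
  rw [map_add, map_smul, map_smul] at h1
  obtain ⟨h3, h4⟩ := haff (1 - s) s (fnL p D.T u) (fnL p D.T v) (by ring)
  have hn : ∀ z z' : Vec N, ‖(1 - s) • z + s • z'‖ ^ 2 =
      ‖z‖ ^ 2 + 2 * s * inner ℝ z (z' - z) + s ^ 2 * ‖z' - z‖ ^ 2 := fun z z' => by
    rw [show (1 - s) • z + s • z' = z + s • (z' - z) by module, norm_add_sq_real,
      inner_smul_right, norm_smul, mul_pow, Real.norm_eq_abs, sq_abs]
    ring
  rw [h3, h4, hn, hn] at h1
  replace h1 : 1 / 2 * (‖x‖ ^ 2 + ‖y‖ ^ 2) + D.energy 0 u ≤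
      1 / 2 * (‖x‖ ^ 2 + 2 * s * inner ℝ x (x' - x) + s ^ 2 * ‖x' - x‖ ^ 2 +
        (‖y‖ ^ 2 + 2 * s * inner ℝ y (y' - y) + s ^ 2 * ‖y' - y‖ ^ 2)) +
      D.energy 0 ((1 - s) • u + s • v) := h1
  replace h2 : D.energy 0 ((1 - s) • u + s • v) ≤
    (1 - s) * D.energy 0 u + s * D.energy 0 v - (1 - s) * s * κ := h2
  have h5 : 0 ≤ s * (D.energy 0 v - D.energy 0 u +
      (inner ℝ b (fnL p D.T v) - inner ℝ b (fnL p D.T u)) - κ +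
      s * (1 / 2 * (‖x' - x‖ ^ 2 + ‖y' - y‖ ^ 2) + κ)) := by
    rw [← hpair]
    linarith
  exact nonneg_of_mul_nonneg_right h5 hs

/-- Each minimizer is compared with the other one. The two functionals differ by at most `εγT√η`,
and quadratic growth turns this into a rate for `‖w η - u‖²`. -/
theorem tendsto_regMinimizer (hD : D.Admissible) {u : H10 p D.T}
    (hu : D.IsOptimalControl u) {P : ℝ → Vec N} (hP : D.IsAdjointState u P)
    {w : ℝ → H10 p D.T} (hw : ∀ η, 0 < η → D.IsRegMinimizer P η (w η)) :
    Tendsto w (𝓝[>] 0) (𝓝 u) := by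
  have hT := hD.T_pos
  have hε := hD.ε_pos
  have hβ := hD.β_pos
  obtain ⟨b, hb⟩ := hP.exists_L2
  set κ := D.ε * D.β / (8 * (D.T ^ 2 + 1)) with hκ
  have hκ0 : 0 < κ := by positivity
  have hbound : ∀ η, 0 < η → ‖w η - u‖ ^ 2 ≤ κ⁻¹ * (D.ε * D.γ * (D.T * √η)) := by
    intro η hη
    have h1 := hu.quadratic_growth hD hP hb (w η)
    have h2 := hw η hη u
    rw [D.regCost_eq hb hη.le, D.regCost_eq hb hη.le] at h2
    have h3 := norm_sq_le_der hD (u - w η)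
    have h4 := mul_le_mul_of_nonneg_left (pen_zero_le hT.le hη.le (derL p D.T (w η)))
      (mul_nonneg hε.le hD.γ_pos.le)
    have h5 := mul_le_mul_of_nonneg_left (pen_le hη.le (derL p D.T u))
      (mul_nonneg hε.le hD.γ_pos.le)
    have h6 : D.energy 0 (w η) ≤ D.energy η (w η) + D.ε * D.γ * (D.T * √η) := by
      simp only [energy]; linarith
    have h7 : D.energy η u ≤ D.energy 0 u := by
      simp only [energy]; linarith
    have h8 : 0 ≤ D.ε * D.β / 2 * ‖derL p D.T (u - w η)‖ ^ 2 := by positivity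
    rw [norm_sub_rev, le_inv_mul_iff₀ hκ0]
    linarith
  rw [tendsto_iff_norm_sub_tendsto_zero]
  have hlim : Tendsto (fun η : ℝ => √(κ⁻¹ * (D.ε * D.γ * (D.T * √η)))) (𝓝[>] 0) (𝓝 0) := by
    have hc : Continuous fun η : ℝ => √(κ⁻¹ * (D.ε * D.γ * (D.T * √η))) := by fun_prop
    have := (hc.tendsto 0).mono_left (nhdsWithin_le_nhds (s := Ioi 0))
    simpa using this
  refine squeeze_zero' (Eventually.of_forall fun _ => norm_nonneg _) ?_ hlim
  filter_upwards [self_mem_nhdsWithin] with η hη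
  exact Real.le_sqrt_of_sq_le (hbound η hη)

end Data

/-! ### Compactness of multipliers and the selecting functional. -/

section Limits

variable {m : ℕ} {T : ℝ}

/-- A bounded superposition operator is continuous on `L²`. -/
theorem continuous_integral_superposition {k : ℝ → Vec m → ℝ} {F : ℝ → ℝ}
    (hF : Integrable F (leb T)) (hk : ∀ t, Continuous (k t))
    (hm : ∀ g : L2 m T, AEStronglyMeasurable (fun t => k t (g t)) (leb T))
    (hb : ∀ t x, ‖k t x‖ ≤ F t) : Continuous fun g : L2 m T => ∫ t, k t (g t) ∂leb T := by
  refine continuous_iff_seqContinuous.2 fun x g hx => ?_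
  -- Convergence in `L²` gives almost everywhere convergence only along a subsequence, which
  -- suffices when every subsequence has one.
  refine tendsto_of_subseq_tendsto fun ns hns => ?_
  obtain ⟨ms, -, hms⟩ := (tendstoInMeasure_of_tendsto_Lp (hx.comp hns)).exists_seq_tendsto_ae
  refine ⟨ms, tendsto_integral_of_dominated_convergence F (fun n => hm _) hF
    (fun n => Eventually.of_forall fun t => hb _ _) ?_⟩
  filter_upwards [hms] with t ht
  exact ((hk t).tendsto _).comp ht

theorem isClosed_ae_norm_le_one : IsClosed {f : L2 m T | ∀ᵐ t ∂leb T, ‖f t‖ ≤ 1} := by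
  refine IsSeqClosed.isClosed fun x f hx hlim => ?_
  obtain ⟨ns, -, hns⟩ := (tendstoInMeasure_of_tendsto_Lp hlim).exists_seq_tendsto_ae
  filter_upwards [hns, ae_all_iff.2 hx] with t h1 h2
  exact le_of_tendsto' h1.norm fun n => h2 _

/-- For `f` merely in `L¹` the pairing with `f` is not available on all of `L²`. The truncation
fixes vectors of norm at most 1, hence all multipliers, and provides the dominating function `|f|`;
strong `L²` convergence thus becomes weak-* convergence. -/
theorem continuous_integral_inner_truncated (f : Lp (Vec m) 1 (leb T)) :
    Continuous fun g : L2 m T =>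
      ∫ t, inner ℝ ((max 1 ‖g t‖)⁻¹ • g t) (f t) ∂leb T := by
  have hc : Continuous fun x : Vec m => (max 1 ‖x‖)⁻¹ • x :=
    ((continuous_const.max continuous_norm).inv₀ fun x => by positivity).smul continuous_id
  refine continuous_integral_superposition (k := fun t x => inner ℝ ((max 1 ‖x‖)⁻¹ • x) (f t))
    (F := fun t => ‖f t‖) (L1.integrable_coeFn f).norm (fun t => hc.inner continuous_const)
    (fun g => (hc.comp_aestronglyMeasurable (Lp.aestronglyMeasurable g)).inner
      (Lp.aestronglyMeasurable f)) fun t x => ?_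
  refine (norm_inner_le_norm _ _).trans (mul_le_of_le_one_left (norm_nonneg _) ?_)
  rw [norm_smul, norm_inv, Real.norm_of_nonneg (by positivity)]
  exact inv_mul_le_one_of_le₀ (le_max_right _ _) (by positivity)

/-- The functional `f ↦ ∫ √(1 - |f|²)` that selects the limit multiplier. -/
def selector (f : L2 m T) : ℝ := ∫ t, √(1 - ‖f t‖ ^ 2) ∂leb T

theorem norm_sqrt_one_sub_le (x : Vec m) : ‖√(1 - ‖x‖ ^ 2)‖ ≤ 1 := by
  rw [Real.norm_of_nonneg (Real.sqrt_nonneg _), Real.sqrt_le_iff]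
  exact ⟨zero_le_one, by linarith [sq_nonneg ‖x‖]⟩

theorem continuous_sqrt_one_sub : Continuous fun x : Vec m => √(1 - ‖x‖ ^ 2) := by fun_prop

theorem continuous_selector : Continuous (selector : L2 m T → ℝ) :=
  continuous_integral_superposition (F := fun _ => 1) (integrable_const _)
    (fun _ => continuous_sqrt_one_sub)
    (fun g => continuous_sqrt_one_sub.comp_aestronglyMeasurable (Lp.aestronglyMeasurable g))
    fun _ x => norm_sqrt_one_sub_le x

theorem integrable_selector (f : L2 m T) : Integrable (fun t => √(1 - ‖f t‖ ^ 2)) (leb T) :=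
  Integrable.of_bound
    (continuous_sqrt_one_sub.comp_aestronglyMeasurable (Lp.aestronglyMeasurable f)) 1
    (Eventually.of_forall fun t => norm_sqrt_one_sub_le (f t))

/-- Strong concavity of `a ↦ √(1 - |a|²)` on the unit ball, at the point `x / √(η + |x|²)`. -/
theorem sqrt_one_sub_add_le {η : ℝ} (hη : 0 < η) (x : Vec m) {a : Vec m} (ha : ‖a‖ ≤ 1) :
    √(1 - ‖a‖ ^ 2) + (√η)⁻¹ * inner ℝ x (a - (√(η + ‖x‖ ^ 2))⁻¹ • x) +
      1 / 2 * ‖a - (√(η + ‖x‖ ^ 2))⁻¹ • x‖ ^ 2 ≤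
      √(1 - ‖(√(η + ‖x‖ ^ 2))⁻¹ • x‖ ^ 2) := by
  set R := √(η + ‖x‖ ^ 2) with hR
  set e := √η with he
  have he0 : 0 < e := Real.sqrt_pos.2 hη
  have hR0 : 0 < R := Real.sqrt_pos.2 (by positivity)
  have hR2 : R ^ 2 = e ^ 2 + ‖x‖ ^ 2 := by
    rw [Real.sq_sqrt (by positivity), Real.sq_sqrt hη.le]
  set l := R⁻¹ • x with hl
  have hx : x = R • l := by rw [hl, smul_inv_smul₀ hR0.ne']
  have hll : ‖l‖ ^ 2 = 1 - (e / R) ^ 2 := by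
    rw [hl, norm_smul, norm_inv, Real.norm_of_nonneg hR0.le]
    field_simp
    linarith
  have heR : e ≤ R := Real.sqrt_le_sqrt (by nlinarith [sq_nonneg ‖x‖])
  set q := e / R with hq
  have hq0 : 0 < q := div_pos he0 hR0
  have hs : e⁻¹ * R = q⁻¹ := by rw [hq]; field_simp
  have hs1 : 1 ≤ q⁻¹ := by rw [hq, inv_div, one_le_div he0]; exact heR
  have hqq : √(1 - ‖l‖ ^ 2) = q := by rw [hll, sub_sub_cancel, Real.sqrt_sq hq0.le]
  set r := √(1 - ‖a‖ ^ 2) with hr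
  have hr2 : ‖a‖ ^ 2 = 1 - r ^ 2 := by
    rw [hr, Real.sq_sqrt (by nlinarith [norm_nonneg a])]; ring
  rw [hqq, hx, inner_smul_left, ← mul_assoc, RCLike.conj_to_real, hs, inner_sub_right,
    real_inner_self_eq_norm_sq, norm_sub_sq_real, hr2, hll, real_inner_comm l a]
  set k := inner ℝ l a with hk
  -- Once the claim is expanded, `k` has the coefficient `q⁻¹ - 1 ≥ 0`, so it may be replaced by
  -- this bound, which is `|a - l|² ≥ 0`. What remains is `-(q - r)²/(2q) ≤ 0`.
  have hk1 : k ≤ 1 - (q ^ 2 + r ^ 2) / 2 := by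
    have h := sq_nonneg ‖a - l‖
    rw [norm_sub_sq_real, hr2, hll, real_inner_comm] at h
    linarith
  have h1 := mul_le_mul_of_nonneg_left hk1 (sub_nonneg.2 hs1)
  have h2 : 0 ≤ q⁻¹ * (q - r) ^ 2 := by positivity
  have h3 : q⁻¹ * (q - r) ^ 2 = q - 2 * r + q⁻¹ * r ^ 2 := by field_simp; ring
  have h4 : q⁻¹ * q ^ 2 = q := by field_simp
  nlinarith

/-- The `L²` functions orthogonal to all derivatives of elements of `H¹₀`. -/
def derOrthogonal (m : ℕ) (T : ℝ) : Submodule ℝ (L2 m T) where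
  carrier := {f | ∀ v : H10 m T, inner ℝ f (derL m T v) = 0}
  zero_mem' := fun v => inner_zero_left _
  add_mem' := fun {a b} ha hb v => by rw [inner_add_left, ha v, hb v, add_zero]
  smul_mem' := fun c a ha v => by rw [real_inner_smul_left, ha v, mul_zero]

theorem finiteDimensional_derOrthogonal (hT : 0 < T) :
    FiniteDimensional ℝ (derOrthogonal m T) := by
  refine Submodule.finiteDimensional_of_le 
    (S₂ := (Lp.constL 2 (leb T) ℝ : Vec m →L[ℝ] L2 m T).range) ?_
  intro f hf
  obtain ⟨c, hc⟩ := ae_eq_const_of_inner_der hT f hf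
  refine ⟨c, Lp.ext ?_⟩
  exact (Lp.coeFn_const ..).trans hc.symm

theorem norm_der_le (v : H10 m T) : ‖derL m T v‖ ≤ ‖v‖ :=
  le_of_sq_le_sq (by rw [H10.norm_sq]; linarith [sq_nonneg ‖fnL m T v‖]) (norm_nonneg _)

/-- The Riesz form of the Dirichlet Laplacian on `H¹₀` is invertible. -/
theorem exists_laplacian_equiv (hT : 0 ≤ T) : ∃ A : H10 m T ≃L[ℝ] H10 m T,
    ∀ v w, inner ℝ (A v) w = inner ℝ (derL m T v) (derL m T w) := by
  let B : H10 m T →L[ℝ] H10 m T →L[ℝ] ℝ := LinearMap.mkContinuous₂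
    (LinearMap.mk₂ ℝ (fun v w => inner ℝ (derL m T v) (derL m T w))
      (fun _ _ _ => by rw [map_add, inner_add_left])
      (fun _ _ _ => by rw [map_smul, real_inner_smul_left, smul_eq_mul])
      (fun _ _ _ => by rw [map_add, inner_add_right])
      (fun _ _ _ => by rw [map_smul, inner_smul_right, smul_eq_mul])) 1 fun v w => by
        rw [one_mul]
        exact (norm_inner_le_norm _ _).trans
          (mul_le_mul (norm_der_le v) (norm_der_le w) (norm_nonneg _) (norm_nonneg _))
  have hB : IsCoercive B := by
    refine ⟨(T ^ 2 + 1)⁻¹, by positivity, fun v => ?_⟩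
    change _ ≤ inner ℝ (derL m T v) (derL m T v)
    rw [real_inner_self_eq_norm_sq, mul_assoc, inv_mul_le_iff₀ (by positivity), ← pow_two]
    exact norm_le_der hT v
  exact ⟨hB.continuousLinearEquivOfBilin, fun v w => hB.continuousLinearEquivOfBilin_apply v w⟩

/-- A bounded family in `L²` whose derivatives converge in `H⁻¹` is relatively compact. -/
theorem exists_tendsto_of_tendsto_der (hT : 0 < T) {ι : Type*} (𝒰 : Ultrafilter ι)
    {l : ι → L2 m T} {C : ℝ} (hl : ∀ᶠ i in 𝒰, ‖l i‖ ≤ C) {k : ι → H10 m T} {k₀ : H10 m T}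
    (hk : Tendsto k 𝒰 (𝓝 k₀))
    (hlk : ∀ᶠ i in 𝒰, ∀ v, inner ℝ (l i) (derL m T v) = inner ℝ (k i) v) :
    ∃ l₀, Tendsto l 𝒰 (𝓝 l₀) := by
  obtain ⟨A, hA⟩ := exists_laplacian_equiv (m := m) hT.le
  -- `g i` is the derivative of the solution of a Dirichlet problem and pairs with derivatives
  -- exactly as `l i` does. So `l i - g i` stays in a ball of the finite-dimensional
  -- `derOrthogonal`, while `g` converges.
  set g : ι → L2 m T := fun i => derL m T (A.symm (k i)) with hg
  have hgl : Tendsto g 𝒰 (𝓝 (derL m T (A.symm k₀))) :=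
    (((derL m T).continuous.comp A.symm.continuous).tendsto k₀).comp hk
  have := finiteDimensional_derOrthogonal (m := m) hT
  have : ProperSpace (derOrthogonal m T) := FiniteDimensional.proper ℝ _
  set S : Set (L2 m T) := Subtype.val '' Metric.closedBall (0 : derOrthogonal m T)
    (C + (‖derL m T (A.symm k₀)‖ + 1))
  have hS : IsCompact S := (isCompact_closedBall _ _).image continuous_subtype_val
  have hmem : ∀ᶠ i in 𝒰, l i - g i ∈ S := by
    have hgb : ∀ᶠ i in 𝒰, ‖g i‖ ≤ ‖derL m T (A.symm k₀)‖ + 1 :=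
      (hgl.norm.eventually (gt_mem_nhds (lt_add_one _))).mono fun i hi => hi.le
    filter_upwards [hl, hlk, hgb] with i h1 h2 h3
    refine ⟨⟨l i - g i, fun v => ?_⟩, ?_, rfl⟩
    · rw [inner_sub_left, h2 v, hg, ← hA, ContinuousLinearEquiv.apply_symm_apply, sub_self]
    · rw [mem_closedBall_zero_iff]
      exact (norm_sub_le _ _).trans (add_le_add h1 h3)
  obtain ⟨y, -, hy⟩ := hS.ultrafilter_le_nhds (𝒰.map fun i => l i - g i)
    (le_principal_iff.2 hmem)
  have hy' : Tendsto (fun i => l i - g i) 𝒰 (𝓝 y) := hy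
  exact ⟨_, by simpa using hy'.add hgl⟩

end Limits

/-! ### The mixed formulation and its uniqueness. -/

/-- The maximum of `(μ, x)` over the unit ball is `|x|`, attained at `x/|x|` when `x ≠ 0`. -/
theorem mem_ball_and_forall_iff {m : ℕ} (l x : Vec m) :
    (l ∈ B₁ m ∧ ∀ μ ∈ B₁ m, inner ℝ (μ - l) x ≤ 0) ↔ ‖l‖ ≤ 1 ∧ inner ℝ l x = ‖x‖ := by
  have hle : ∀ μ : Vec m, ‖μ‖ ≤ 1 → inner ℝ μ x ≤ ‖x‖ := fun μ hμ =>
    (real_inner_le_norm _ _).trans (mul_le_of_le_one_left (norm_nonneg _) hμ)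
  refine and_congr_right fun hl => ⟨fun h => le_antisymm (hle l hl) ?_, fun h μ hμ => ?_⟩
  · by_cases hx : x = 0
    · simp [hx]
    · have hx0 : ‖x‖ ≠ 0 := norm_ne_zero_iff.2 hx
      have h1 := h (‖x‖⁻¹ • x) (by simp [B₁, norm_smul, hx0])
      rw [inner_sub_left, real_inner_smul_left, real_inner_self_eq_norm_sq, pow_two,
        inv_mul_cancel_left₀ hx0] at h1
      linarith
  · rw [inner_sub_left, h]
    linarith [hle μ hμ]

theorem eq_inv_norm_smul {m : ℕ} {l x : Vec m} (hx : x ≠ 0) (hl : ‖l‖ ≤ 1)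
    (h : inner ℝ l x = ‖x‖) : l = ‖x‖⁻¹ • x := by
  have hx0 : ‖x‖ ≠ 0 := norm_ne_zero_iff.2 hx
  have h1 : ‖l - ‖x‖⁻¹ • x‖ ^ 2 = ‖l‖ ^ 2 - 1 := by
    rw [norm_sub_sq_real, inner_smul_right, h, norm_smul, norm_inv, norm_norm,
      inv_mul_cancel₀ hx0]
    ring
  have h2 : ‖l - ‖x‖⁻¹ • x‖ ^ 2 ≤ 0 := by
    rw [h1]; nlinarith [norm_nonneg l]
  have h3 : ‖l - ‖x‖⁻¹ • x‖ = 0 := by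
    have := le_antisymm h2 (sq_nonneg _)
    exact pow_eq_zero_iff two_ne_zero |>.1 this
  exact sub_eq_zero.1 (norm_eq_zero.1 h3)

/-- The Riesz representative of `v ↦ ⟪l, d v⟫` given by an Euler equation. -/
theorem exists_continuous_representative {H L : Type*} [NormedAddCommGroup H]
    [InnerProductSpace ℝ H] [CompleteSpace H] [NormedAddCommGroup L] [InnerProductSpace ℝ L]
    [CompleteSpace L] (f d : H →L[ℝ] L) (b : L) (α β : ℝ) {ε γ : ℝ} (hε : ε ≠ 0) (hγ : γ ≠ 0) :
    ∃ k : H → H, Continuous k ∧ ∀ (u : H) (l : L),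
      (∀ v, ε * (α * inner ℝ (f u) (f v) + β * inner ℝ (d u) (d v) + γ * inner ℝ l (d v)) +
        inner ℝ b (f v) = 0) → ∀ v, inner ℝ l (d v) = inner ℝ (k u) v := by
  refine ⟨fun u => -(γ⁻¹ • (α • f.adjoint (f u) + β • d.adjoint (d u) + ε⁻¹ • f.adjoint b)),
    by fun_prop, fun u l h v => ?_⟩
  have h1 := h v
  rw [inner_neg_left, real_inner_smul_left, inner_add_left, inner_add_left, real_inner_smul_left,
    real_inner_smul_left, real_inner_smul_left, ContinuousLinearMap.adjoint_inner_left,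
    ContinuousLinearMap.adjoint_inner_left, ContinuousLinearMap.adjoint_inner_left]
  field_simp
  linarith

namespace Data

variable {N p : ℕ} (D : Data N p)

/-- The left-hand side of the state equation of the mixed formulation. -/
def mixedForm (b : L2 p D.T) (u : H10 p D.T) (l : L2 p D.T) (v : H10 p D.T) : ℝ :=
  D.ε * (D.α * inner ℝ (fnL p D.T u) (fnL p D.T v) +
    D.β * inner ℝ (derL p D.T u) (derL p D.T v) + D.γ * inner ℝ l (derL p D.T v)) +
    inner ℝ b (fnL p D.T v)

/-- The mixed formulation for a multiplier in `L²`. -/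
structure IsMixedL2 (b : L2 p D.T) (u : H10 p D.T) (l : L2 p D.T) : Prop where
  form_eq_zero : ∀ v, D.mixedForm b u l v = 0
  pointwise : ∀ᵐ t ∂leb D.T, ‖l t‖ ≤ 1 ∧ inner ℝ (l t) (u.der t) = ‖u.der t‖

theorem isMixedSolution_iff {P : ℝ → Vec N} {b : L2 p D.T}
    (hb : (b : ℝ → Vec p) =ᵐ[leb D.T] fun t => act D.B.transpose (P t)) (u : H10 p D.T)
    {lam : LInf p D.T} {l : L2 p D.T} (hl : (l : ℝ → Vec p) =ᵐ[leb D.T] lam) :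
    D.IsMixedSolution P u lam ↔ D.IsMixedL2 b u l := by
  have hform : ∀ v : H10 p D.T,
      D.ε * (∫ t, (D.α * inner ℝ (u.fn t) (v.fn t) + D.β * inner ℝ (u.der t) (v.der t) +
        D.γ * inner ℝ (lam t) (v.der t)) ∂leb D.T) +
      ∫ t, inner ℝ (act D.B.transpose (P t)) (v.fn t) ∂leb D.T = D.mixedForm b u l v := by
    intro v
    have i1 := (L2.integrable_inner (𝕜 := ℝ) u.fn v.fn).const_mul D.α
    have i2 := (L2.integrable_inner (𝕜 := ℝ) u.der v.der).const_mul D.β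
    have i3 := (L2.integrable_inner (𝕜 := ℝ) l v.der).const_mul D.γ
    have e1 : ∫ t, (D.α * inner ℝ (u.fn t) (v.fn t) + D.β * inner ℝ (u.der t) (v.der t) +
        D.γ * inner ℝ (lam t) (v.der t)) ∂leb D.T =
        ∫ t, (D.α * inner ℝ (u.fn t) (v.fn t) + D.β * inner ℝ (u.der t) (v.der t) +
        D.γ * inner ℝ (l t) (v.der t)) ∂leb D.T := by
      refine integral_congr_ae ?_
      filter_upwards [hl] with t ht
      rw [ht]
    have e2 : ∫ t, inner ℝ (act D.B.transpose (P t)) (v.fn t) ∂leb D.T =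
        ∫ t, inner ℝ (b t) (v.fn t) ∂leb D.T := by
      refine integral_congr_ae ?_
      filter_upwards [hb] with t ht
      rw [ht]
    rw [e1, e2, integral_add_add i1 i2 i3, integral_const_mul, integral_const_mul,
      integral_const_mul]
    rfl
  have hpt : (∀ᵐ t ∂leb D.T, lam t ∈ B₁ p ∧ ∀ μ ∈ B₁ p, inner ℝ (μ - lam t) (u.der t) ≤ 0) ↔
      ∀ᵐ t ∂leb D.T, ‖l t‖ ≤ 1 ∧ inner ℝ (l t) (u.der t) = ‖u.der t‖ := by
    refine eventually_congr ?_
    filter_upwards [hl] with t ht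
    rw [ht, mem_ball_and_forall_iff]
  simp only [IsMixedSolution, hform, hpt]
  exact ⟨fun h => ⟨h.1, h.2⟩, fun h => ⟨h.1, h.2⟩⟩

variable {D}

theorem eq_zero_of_derL_eq_zero {m : ℕ} {T : ℝ} (hT : 0 ≤ T) {v : H10 m T}
    (h : derL m T v = 0) : v = 0 := by
  have h1 := norm_le_der hT v
  rw [h, norm_zero, zero_pow two_ne_zero, mul_zero] at h1
  exact norm_eq_zero.1 (pow_eq_zero_iff two_ne_zero |>.1 (le_antisymm h1 (sq_nonneg _)))

/-- Monotonicity of the subdifferential of the norm, to which each multiplier belongs pointwise. -/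
theorem IsMixedL2.inner_nonneg {b : L2 p D.T} {u₁ u₂ : H10 p D.T} {l₁ l₂ : L2 p D.T}
    (h₁ : D.IsMixedL2 b u₁ l₁) (h₂ : D.IsMixedL2 b u₂ l₂) :
    0 ≤ inner ℝ (l₁ - l₂) (derL p D.T (u₁ - u₂)) := by
  rw [map_sub, MeasureTheory.L2.inner_def]
  refine integral_nonneg_of_ae ?_
  filter_upwards [h₁.pointwise, h₂.pointwise, Lp.coeFn_sub l₁ l₂,
    Lp.coeFn_sub (derL p D.T u₁) (derL p D.T u₂)] with t e1 e2 e3 e4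
  rw [e3, e4, Pi.sub_apply, Pi.sub_apply, inner_sub_left, inner_sub_right, inner_sub_right,
    ← H10.der_eq, ← H10.der_eq, e1.2, e2.2]
  have f1 := (real_inner_le_norm (l₁ t) (u₂.der t)).trans
    (mul_le_of_le_one_left (norm_nonneg _) e1.1)
  have f2 := (real_inner_le_norm (l₂ t) (u₁.der t)).trans
    (mul_le_of_le_one_left (norm_nonneg _) e2.1)
  simp only [Pi.zero_apply]
  linarith

theorem IsMixedL2.control_unique (hD : D.Admissible) {b : L2 p D.T} {u₁ u₂ : H10 p D.T}
    {l₁ l₂ : L2 p D.T} (h₁ : D.IsMixedL2 b u₁ l₁) (h₂ : D.IsMixedL2 b u₂ l₂) : u₁ = u₂ := by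
  have h := h₁.inner_nonneg h₂
  have e1 := h₁.form_eq_zero (u₁ - u₂)
  have e2 := h₂.form_eq_zero (u₁ - u₂)
  have e3 : D.ε * (D.α * ‖fnL p D.T (u₁ - u₂)‖ ^ 2 + D.β * ‖derL p D.T (u₁ - u₂)‖ ^ 2 +
      D.γ * inner ℝ (l₁ - l₂) (derL p D.T (u₁ - u₂))) = 0 := by
    rw [← real_inner_self_eq_norm_sq, ← real_inner_self_eq_norm_sq]
    simp only [mixedForm] at e1 e2
    nth_rewrite 1 [map_sub (fnL p D.T)]
    nth_rewrite 1 [map_sub (derL p D.T)]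
    rw [inner_sub_left, inner_sub_left, inner_sub_left]
    linarith
  have f1 := mul_nonneg hD.α_nonneg (sq_nonneg ‖fnL p D.T (u₁ - u₂)‖)
  have f2 := mul_nonneg hD.γ_pos.le h
  have f3 := (mul_eq_zero.1 e3).resolve_left hD.ε_pos.ne'
  have f4 : ‖derL p D.T (u₁ - u₂)‖ ^ 2 = 0 := by
    have := hD.β_pos
    have g : D.β * ‖derL p D.T (u₁ - u₂)‖ ^ 2 ≤ 0 := by linarith
    exact le_antisymm (nonpos_of_mul_nonpos_right g this) (sq_nonneg _)
  exact sub_eq_zero.1 (eq_zero_of_derL_eq_zero hD.T_pos.le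
    (norm_eq_zero.1 (pow_eq_zero_iff two_ne_zero |>.1 f4)))

theorem IsMixedL2.inner_sub_der_eq_zero (hD : D.Admissible) {b : L2 p D.T} {u : H10 p D.T}
    {l₁ l₂ : L2 p D.T} (h₁ : D.IsMixedL2 b u l₁) (h₂ : D.IsMixedL2 b u l₂) (v : H10 p D.T) :
    inner ℝ (l₁ - l₂) (derL p D.T v) = 0 := by
  have e1 := h₁.form_eq_zero v
  have e2 := h₂.form_eq_zero v
  simp only [mixedForm] at e1 e2
  have : D.ε * D.γ * (inner ℝ l₁ (derL p D.T v) - inner ℝ l₂ (derL p D.T v)) = 0 := by linarith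
  rw [inner_sub_left]
  exact (mul_eq_zero.1 this).resolve_left (mul_pos hD.ε_pos hD.γ_pos).ne'

/-- By du Bois-Reymond the difference is a constant `c`. Where `u' ≠ 0` both multipliers equal
`u'/|u'|`, so `c ≠ 0` would force `u' = 0` almost everywhere, hence `u = 0`. -/
theorem IsMixedL2.multiplier_unique (hD : D.Admissible) {b : L2 p D.T} {u : H10 p D.T}
    (hu : u ≠ 0) {l₁ l₂ : L2 p D.T} (h₁ : D.IsMixedL2 b u l₁) (h₂ : D.IsMixedL2 b u l₂) :
    l₁ = l₂ := by
  obtain ⟨c, hc⟩ := ae_eq_const_of_inner_der hD.T_pos (l₁ - l₂)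
    (h₁.inner_sub_der_eq_zero hD h₂)
  by_cases hc0 : c = 0
  · refine sub_eq_zero.1 (Lp.ext (hc.trans ?_))
    rw [hc0]
    exact (Lp.coeFn_zero _ _ _).symm
  · refine absurd (eq_zero_of_derL_eq_zero hD.T_pos.le (Lp.ext ?_)) hu
    filter_upwards [hc, Lp.coeFn_sub l₁ l₂, h₁.pointwise, h₂.pointwise,
      Lp.coeFn_zero (Vec p) 2 (leb D.T)] with t e1 e2 e3 e4 e5
    rw [e5, Pi.zero_apply]
    by_contra hne
    refine hc0 ?_
    rw [← e1, e2, Pi.sub_apply, eq_inv_norm_smul hne e3.1 e3.2, eq_inv_norm_smul hne e4.1 e4.2,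
      sub_self]

/-! ### Convergence of the regularized multipliers. -/

theorem norm_multL2_le (hT : 0 ≤ D.T) {η : ℝ} (hη : 0 ≤ η) (w : H10 p D.T) :
    ‖multL2 η w‖ ≤ √D.T := by
  refine Real.le_sqrt_of_sq_le ?_
  have h : ∫ _, (1 : ℝ) ∂leb D.T = D.T := by simp [leb, hT]
  rw [L2.norm_sq_eq]
  refine le_of_le_of_eq ?_ h
  refine integral_mono_ae (L2.integrable_norm_sq _) (integrable_const _) ?_
  filter_upwards [coeFn_multL2 hη w] with t ht
  rw [ht]
  exact pow_le_one₀ (norm_nonneg _) (norm_multiplier_le hη w t)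

/-- Pointwise, `|x|²/√(η + |x|²) ≥ |x| - √η`. In the limit `η → 0` this gives `(l, u') ≥ ∫ |u'|`. -/
theorem pen_zero_sub_le_inner (hT : 0 ≤ D.T) {η : ℝ} (hη : 0 < η) (w : H10 p D.T) :
    pen 0 (derL p D.T w) - D.T * √η ≤ inner ℝ (multL2 η w) (derL p D.T w) := by
  have h : ∫ t, (smoothNorm 0 (derL p D.T w t) - √η) ∂leb D.T =
      pen 0 (derL p D.T w) - D.T * √η := by
    rw [integral_sub (integrable_smoothNorm le_rfl _) (integrable_const _), integral_const]
    simp [pen, leb, hT]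
  rw [← h, MeasureTheory.L2.inner_def]
  refine integral_mono_ae ((integrable_smoothNorm le_rfl _).sub (integrable_const _))
    (L2.integrable_inner (𝕜 := ℝ) _ _) ?_
  filter_upwards [coeFn_multL2 hη.le w] with t ht
  simp only [smoothNorm_zero]
  rw [ht, multiplier, H10.der_eq, real_inner_smul_left, real_inner_self_eq_norm_sq]
  set x := ‖derL p D.T w t‖
  have hx : 0 ≤ x := norm_nonneg _
  have hs : 0 < √η := Real.sqrt_pos.2 hη
  have hR : 0 < √(η + x ^ 2) := Real.sqrt_pos.2 (by positivity)
  have hle : √(η + x ^ 2) ≤ x + √η :=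
    Real.sqrt_le_iff.2 ⟨by positivity, by nlinarith [Real.sq_sqrt hη.le, mul_nonneg hx hs.le]⟩
  have hge : √η ≤ √(η + x ^ 2) := Real.sqrt_le_sqrt (by nlinarith)
  rw [le_inv_mul_iff₀ hR]
  nlinarith [mul_nonneg hx (sub_nonneg.2 hle), Real.sq_sqrt hη.le,
    mul_nonneg hs.le (sub_nonneg.2 hge)]

/-- The regularized multiplier almost maximizes the selector among the multipliers of `0`. -/
theorem selector_add_le (hD : D.Admissible) {P : ℝ → Vec N} {b : L2 p D.T}
    (hb : (b : ℝ → Vec p) =ᵐ[leb D.T] fun t => act D.B.transpose (P t)) {η : ℝ} (hη : 0 < η)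
    {w : H10 p D.T} (hw : D.IsRegMinimizer P η w) {l : L2 p D.T} (hl : D.IsMixedL2 b 0 l) :
    selector l + 1 / 2 * ‖l - multL2 η w‖ ^ 2 ≤ selector (multL2 η w) := by
  have he1 := hw.euler hD hb hη w
  have he2 := hl.form_eq_zero w
  simp only [mixedForm, map_zero, inner_zero_left, mul_zero, zero_add] at he2
  -- Both equations are tested with `w`. That of `l` has no `α` and `β` terms, its control being 0,
  -- so the difference reads `γ(l - λ, w') = α‖w‖² + β‖w'‖²`.
  have hpos : 0 ≤ inner ℝ (derL p D.T w) (l - multL2 η w) := by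
    rw [real_inner_self_eq_norm_sq, real_inner_self_eq_norm_sq] at he1
    rw [inner_sub_right, real_inner_comm, real_inner_comm _ (derL p D.T w)]
    have h1 : D.ε * (D.γ * (inner ℝ l (derL p D.T w) - inner ℝ (multL2 η w) (derL p D.T w))) =
        D.ε * (D.α * ‖fnL p D.T w‖ ^ 2 + D.β * ‖derL p D.T w‖ ^ 2) := by linarith
    have h2 := mul_left_cancel₀ hD.ε_pos.ne' h1
    have h3 := mul_nonneg hD.α_nonneg (sq_nonneg ‖fnL p D.T w‖)
    have h4 := mul_nonneg hD.β_pos.le (sq_nonneg ‖derL p D.T w‖)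
    refine nonneg_of_mul_nonneg_right ?_ hD.γ_pos
    rw [h2]; linarith
  have hpos2 : 0 ≤ (√η)⁻¹ * inner ℝ (derL p D.T w) (l - multL2 η w) :=
    mul_nonneg (inv_nonneg.2 (Real.sqrt_nonneg _)) hpos
  have i1 := integrable_selector l
  have i2 := (L2.integrable_inner (𝕜 := ℝ) (derL p D.T w) (l - multL2 η w)).const_mul (√η)⁻¹
  have i3 := (L2.integrable_norm_sq (l - multL2 η w)).const_mul (1 / 2)
  have key : selector l + (√η)⁻¹ * inner ℝ (derL p D.T w) (l - multL2 η w) +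
      1 / 2 * ‖l - multL2 η w‖ ^ 2 ≤ selector (multL2 η w) := by
    rw [MeasureTheory.L2.inner_def, L2.norm_sq_eq, ← integral_const_mul, ← integral_const_mul,
      selector, selector, ← integral_add_add i1 i2 i3]
    refine integral_mono_ae ((i1.add i2).add i3) (integrable_selector _) ?_
    filter_upwards [hl.pointwise, coeFn_multL2 hη.le w, Lp.coeFn_sub l (multL2 η w)] with t h1 h2 h3
    rw [h3, Pi.sub_apply, h2]
    exact sqrt_one_sub_add_le hη _ h1.1
  linarith

theorem continuous_mixedForm (b : L2 p D.T) (v : H10 p D.T) :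
    Continuous fun x : H10 p D.T × L2 p D.T => D.mixedForm b x.1 x.2 v := by
  unfold mixedForm
  fun_prop

/-- A limit of regularized multipliers solves the mixed formulation. -/
theorem isMixedL2_of_tendsto (hD : D.Admissible) {P : ℝ → Vec N} {b : L2 p D.T}
    (hb : (b : ℝ → Vec p) =ᵐ[leb D.T] fun t => act D.B.transpose (P t)) {w : ℝ → H10 p D.T}
    (hw : ∀ η, 0 < η → D.IsRegMinimizer P η (w η)) {𝒰 : Filter ℝ} [𝒰.NeBot] (h𝒰 : 𝒰 ≤ 𝓝[>] 0)
    {u : H10 p D.T} (hu : Tendsto w 𝒰 (𝓝 u)) {l : L2 p D.T}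
    (hl : Tendsto (fun η => multL2 η (w η)) 𝒰 (𝓝 l)) : D.IsMixedL2 b u l := by
  have hT := hD.T_pos.le
  have hpos : ∀ᶠ η in 𝒰, 0 < η := h𝒰 self_mem_nhdsWithin
  have hder : Tendsto (fun η => derL p D.T (w η)) 𝒰 (𝓝 (derL p D.T u)) :=
    ((derL p D.T).continuous.tendsto u).comp hu
  have hball : ∀ᵐ t ∂leb D.T, ‖l t‖ ≤ 1 := by
    refine isClosed_ae_norm_le_one.mem_of_tendsto hl ?_
    filter_upwards [hpos] with η hη
    filter_upwards [coeFn_multL2 hη.le (w η)] with t ht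
    rw [ht]
    exact norm_multiplier_le hη.le _ _
  refine ⟨fun v => ?_, ?_⟩
  · have h1 := ((continuous_mixedForm b v).tendsto (u, l)).comp (hu.prodMk_nhds hl)
    refine tendsto_nhds_unique (h1.congr' ?_) tendsto_const_nhds
    filter_upwards [hpos] with η hη
    exact (hw η hη).euler hD hb hη v
  -- Only this integral inequality passes to the limit. As `(l, u') ≤ |u'|` holds pointwise by `|l|
  -- ≤ 1`, the integrals agree and equality holds almost everywhere.
  · have hlim : pen 0 (derL p D.T u) ≤ inner ℝ l (derL p D.T u) := by
      have h1 : Tendsto (fun η => pen 0 (derL p D.T (w η)) - D.T * √η) 𝒰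
          (𝓝 (pen 0 (derL p D.T u) - D.T * √0)) := by
        refine (((continuous_pen hT le_rfl).tendsto _).comp hder).sub ?_
        have hc : Continuous fun η : ℝ => D.T * √η := by fun_prop
        exact ((hc.tendsto 0).mono_left nhdsWithin_le_nhds).mono_left h𝒰
      rw [Real.sqrt_zero, mul_zero, sub_zero] at h1
      refine le_of_tendsto_of_tendsto h1 (hl.inner hder) ?_
      filter_upwards [hpos] with η hη
      exact pen_zero_sub_le_inner hT hη _
    have i1 := integrable_smoothNorm le_rfl (derL p D.T u)
    have i2 := L2.integrable_inner (𝕜 := ℝ) l (derL p D.T u)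
    have hnn : 0 ≤ᵐ[leb D.T] fun t =>
        smoothNorm 0 (derL p D.T u t) - inner ℝ (l t) (derL p D.T u t) := by
      filter_upwards [hball] with t ht
      rw [smoothNorm_zero, Pi.zero_apply, sub_nonneg]
      exact (real_inner_le_norm _ _).trans (mul_le_of_le_one_left (norm_nonneg _) ht)
    have hz : ∫ t, (smoothNorm 0 (derL p D.T u t) - inner ℝ (l t) (derL p D.T u t)) ∂leb D.T =
        0 := by
      refine le_antisymm ?_ (integral_nonneg_of_ae hnn)
      rw [integral_sub i1 i2]
      exact sub_nonpos.2 hlim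
    filter_upwards [hball, (integral_eq_zero_iff_of_nonneg_ae hnn (i1.sub i2)).1 hz] with t h1 h2
    rw [smoothNorm_zero, Pi.zero_apply, sub_eq_zero] at h2
    exact ⟨h1, h2.symm⟩

/-- The regularized multipliers converge, even if the limit problem has several multipliers. -/
theorem exists_tendsto_multL2 (hD : D.Admissible) {P : ℝ → Vec N} {b : L2 p D.T}
    (hb : (b : ℝ → Vec p) =ᵐ[leb D.T] fun t => act D.B.transpose (P t)) {w : ℝ → H10 p D.T}
    (hw : ∀ η, 0 < η → D.IsRegMinimizer P η (w η)) {u : H10 p D.T}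
    (hu : Tendsto w (𝓝[>] 0) (𝓝 u)) :
    ∃ l : L2 p D.T, Tendsto (fun η => multL2 η (w η)) (𝓝[>] 0) (𝓝 l) := by
  obtain ⟨k, hk, hkl⟩ := exists_continuous_representative (fnL p D.T) (derL p D.T) b D.α D.β
    hD.ε_pos.ne' hD.γ_pos.ne'
  have hex : ∀ 𝒰 : Ultrafilter ℝ, ↑𝒰 ≤ 𝓝[>] (0 : ℝ) →
      ∃ l : L2 p D.T, Tendsto (fun η => multL2 η (w η)) 𝒰 (𝓝 l) := by
    intro 𝒰 h𝒰
    have hpos : ∀ᶠ η in (𝒰 : Filter ℝ), 0 < η := h𝒰 self_mem_nhdsWithin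
    refine exists_tendsto_of_tendsto_der hD.T_pos 𝒰 (C := √D.T)
      (hpos.mono fun η hη => norm_multL2_le hD.T_pos.le hη.le _)
      ((hk.tendsto u).comp (hu.mono_left h𝒰)) (hpos.mono fun η hη => ?_)
    exact hkl (w η) _ fun v => (hw η hη).euler hD hb hη v
  -- The limit along one ultrafilter is the candidate; it remains to see that every other
  -- ultrafilter has the same limit.
  obtain ⟨l, hl⟩ := hex (Ultrafilter.of (𝓝[>] 0)) (Ultrafilter.of_le _)
  refine ⟨l, (tendsto_iff_ultrafilter _ _ _).2 fun 𝒰 h𝒰 => ?_⟩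
  obtain ⟨l', hl'⟩ := hex 𝒰 h𝒰
  have hm := isMixedL2_of_tendsto hD hb hw (Ultrafilter.of_le _)
    (hu.mono_left (Ultrafilter.of_le _)) hl
  have hm' := isMixedL2_of_tendsto hD hb hw h𝒰 (hu.mono_left h𝒰) hl'
  suffices l' = l by rwa [← this]
  by_cases hu0 : u = 0
  · subst hu0
    -- Both limits are multipliers of 0, so this comparison holds with their roles exchanged; the
    -- sum of the two inequalities gives `‖l' - l‖² ≤ 0`.
    have hle : ∀ (𝒱 : Ultrafilter ℝ) (_ : ↑𝒱 ≤ 𝓝[>] (0 : ℝ)) (l₁ l₂ : L2 p D.T),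
        Tendsto (fun η => multL2 η (w η)) 𝒱 (𝓝 l₁) → D.IsMixedL2 b 0 l₂ →
        selector l₂ + 1 / 2 * ‖l₂ - l₁‖ ^ 2 ≤ selector l₁ := by
      intro 𝒱 h𝒱 l₁ l₂ h1 h2
      have t1 : Tendsto (fun η => selector l₂ + 1 / 2 * ‖l₂ - multL2 η (w η)‖ ^ 2) 𝒱
          (𝓝 (selector l₂ + 1 / 2 * ‖l₂ - l₁‖ ^ 2)) :=
        tendsto_const_nhds.add (tendsto_const_nhds.mul ((tendsto_const_nhds.sub h1).norm.pow 2))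
      refine le_of_tendsto_of_tendsto t1 ((continuous_selector.tendsto _).comp h1) ?_
      filter_upwards [h𝒱 self_mem_nhdsWithin] with η hη
      exact selector_add_le hD hb hη (hw η hη) h2
    have a1 := hle _ (Ultrafilter.of_le _) l l' hl hm'
    have a2 := hle _ h𝒰 l' l hl' hm
    rw [norm_sub_rev] at a2
    have a3 : ‖l' - l‖ ^ 2 = 0 := le_antisymm (by linarith) (sq_nonneg _)
    exact sub_eq_zero.1 (norm_eq_zero.1 (pow_eq_zero_iff two_ne_zero |>.1 a3))
  · exact hm'.multiplier_unique hD hu0 hm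

theorem tendstoWeakStar_multiplier {m : ℕ} {T : ℝ} {w : ℝ → H10 m T} {l : L2 m T} {lam : LInf m T}
    (hl : Tendsto (fun η => multL2 η (w η)) (𝓝[>] 0) (𝓝 l))
    (hlam : (l : ℝ → Vec m) =ᵐ[leb T] lam) (hball : ∀ᵐ t ∂leb T, ‖l t‖ ≤ 1) :
    TendstoWeakStar (fun η => multiplier η (w η)) (𝓝[>] 0) lam := by
  refine ⟨?_, fun f => ?_⟩
  · filter_upwards [self_mem_nhdsWithin] with η hη
    exact memLp_multiplier (le_of_lt hη) _ _
  · have h := ((continuous_integral_inner_truncated f).tendsto l).comp hl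
    have hcut : ∀ x : Vec m, ‖x‖ ≤ 1 → (max 1 ‖x‖)⁻¹ • x = x := fun x hx => by
      rw [max_eq_left hx, inv_one, one_smul]
    have e1 : ∫ t, inner ℝ ((max 1 ‖l t‖)⁻¹ • l t) (f t) ∂leb T =
        ∫ t, inner ℝ (lam t) (f t) ∂leb T := by
      refine integral_congr_ae ?_
      filter_upwards [hball, hlam] with t h1 h2
      rw [hcut _ h1, h2]
    rw [e1] at h
    refine h.congr' ?_
    filter_upwards [self_mem_nhdsWithin] with η hη
    refine integral_congr_ae ?_
    filter_upwards [coeFn_multL2 (le_of_lt hη) (w η)] with t ht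
    simp only [ht]
    rw [hcut _ (norm_multiplier_le (le_of_lt hη) _ _)]

end Data

end OptCtrl

end

/-! ### Assembly. -/

theorem mainTheorem5 {N p : ℕ} (D : OptCtrl.Data N p) (hD : D.Admissible) :
    -- existence and uniqueness of the optimal control
    (∃! u : OptCtrl.H10 p D.T, D.IsOptimalControl u) ∧
    ∀ u : OptCtrl.H10 p D.T, D.IsOptimalControl u →
      (∃ P, D.IsAdjointState u P) ∧
      ∀ P, D.IsAdjointState u P →
        -- existence and uniqueness of the regularized minimizers
        (∀ η : ℝ, 0 < η → ∃! w : OptCtrl.H10 p D.T, D.IsRegMinimizer P η w) ∧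
        ∃ lam : OptCtrl.LInf p D.T,
          -- convergence as the regularization parameter tends to zero
          (∀ w : ℝ → OptCtrl.H10 p D.T, (∀ η : ℝ, 0 < η → D.IsRegMinimizer P η (w η)) →
            Tendsto w (𝓝[>] 0) (𝓝 u) ∧
            OptCtrl.TendstoWeakStar (fun η => OptCtrl.multiplier η (w η)) (𝓝[>] 0) lam) ∧
          -- the mixed formulation, with its pointwise identity
          D.IsMixedSolution P u lam ∧
          (∀ᵐ t ∂OptCtrl.leb D.T, inner ℝ (lam t) (u.der t) = ‖u.der t‖) ∧
          -- uniqueness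
          (∀ (u' : OptCtrl.H10 p D.T) (lam' : OptCtrl.LInf p D.T),
            D.IsMixedSolution P u' lam' → u' = u ∧ (u ≠ 0 → lam' = lam)) := by
  refine ⟨OptCtrl.Data.existsUnique_isOptimalControl hD, fun u hu =>
    ⟨OptCtrl.Data.exists_isAdjointState hD u, fun P hP => ?_⟩⟩
  obtain ⟨b, hb⟩ := hP.exists_L2
  have hreg : ∀ η : ℝ, 0 < η → ∃! w : OptCtrl.H10 p D.T, D.IsRegMinimizer P η w :=
    fun η hη => OptCtrl.Data.existsUnique_regMinimizer hD hb hη.le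
  refine ⟨hreg, ?_⟩
  -- One family of minimizers is fixed to define the multiplier; its value 0 for `η ≤ 0` is
  -- irrelevant. Any other family agrees with it for `η > 0`, so `lam` does not depend on the
  -- choice.
  have hw₀ : ∀ η : ℝ, ∃ w : OptCtrl.H10 p D.T, 0 < η → D.IsRegMinimizer P η w := fun η => by
    by_cases hη : 0 < η
    · obtain ⟨w, hw, -⟩ := hreg η hη
      exact ⟨w, fun _ => hw⟩
    · exact ⟨0, fun h => absurd h hη⟩
  choose w₀ hw₀ using hw₀
  have hu₀ := OptCtrl.Data.tendsto_regMinimizer hD hu hP hw₀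
  obtain ⟨l, hl⟩ := OptCtrl.Data.exists_tendsto_multL2 hD hb hw₀ hu₀
  have hmix := OptCtrl.Data.isMixedL2_of_tendsto hD hb hw₀ le_rfl hu₀ hl
  have hmem : MemLp l ⊤ (OptCtrl.leb D.T) :=
    memLp_top_of_bound (Lp.aestronglyMeasurable l) 1 (hmix.pointwise.mono fun t ht => ht.1)
  have hlam := hmem.coeFn_toLp.symm
  refine ⟨hmem.toLp l, fun w hw => ⟨OptCtrl.Data.tendsto_regMinimizer hD hu hP hw, ?_⟩,
    (OptCtrl.Data.isMixedSolution_iff D hb u hlam).2 hmix, ?_, fun u' lam' h' => ?_⟩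
  · refine OptCtrl.Data.tendstoWeakStar_multiplier (hl.congr' ?_) hlam
      (hmix.pointwise.mono fun t ht => ht.1)
    filter_upwards [self_mem_nhdsWithin] with η hη
    rw [(hreg η hη).unique (hw₀ η hη) (hw η hη)]
  · filter_upwards [hmix.pointwise, hlam] with t h1 h2
    rw [← h2]
    exact h1.2
  · have hmem' : MemLp lam' 2 (OptCtrl.leb D.T) := (Lp.memLp lam').mono_exponent le_top
    have h2 := (OptCtrl.Data.isMixedSolution_iff D hb u' hmem'.coeFn_toLp).1 h'
    have huu := h2.control_unique hD hmix
    subst huu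
    refine ⟨rfl, fun hne => Lp.ext ?_⟩
    have h3 := h2.multiplier_unique hD hne hmix
    exact (hmem'.coeFn_toLp.symm.trans (h3 ▸ Filter.EventuallyEq.rfl)).trans hlam
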